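/- Let $q$ be a prime power, let $t$ be a positive integer, let $V$ be a $t$-dimensional vector space over $\mathbb F_{q^t}$, and let $\mathrm{PG}(t-1,q^t)$ be the projective space of the one-dimensional $\mathbb F_{q^t}$-subspaces $\langle v\rangle$ of $V$. Let $\Sigma=\{\langle w\rangle : w\in W\setminus\{0\}\}$ be a canonical subgeometry of order $q$, that is, $W$ is a $t$-dimensional $\mathbb F_q$-subspace of $V$ that spans $V$ over $\mathbb F_{q^t}$; a hyperplane of $\Sigma$ is the set of the points $\langle w\rangle$, $w\in W'\setminus\{0\}$, for a $(t-1)$-dimensional $\mathbb F_q$-subspace $W'$ of $W$. Let $\ell$ be a line of $\mathrm{PG}(t-1,q^t)$ that is disjoint from $\Sigma$ and not contained in the span of any hyperplane of $\Sigma$ (so that $t\ge 3$). The splash $\mathbf L$ of $\Sigma$ on $\ell$ is the set of the intersection points of $\ell$ with the spans of the hyperplanes of $\Sigma$. A point set of $\ell$ is a scattered $\mathbb F_q$-linear set of rank $t$ if it consists of the points $\langle u\rangle$, $u\in U\setminus\{0\}$, for a $t$-dimensional $\mathbb F_q$-subspace $U$ of $V$, and has exactly $(q^t-1)/(q-1)$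 points. It is of pseudoregulus type if it is the image of $\mathbf L_0=\{\langle(\lambda,\lambda^q)\rangle : \lambda\in\mathbb F_{q^t}^*\}$ under a projectivity from $\mathrm{PG}(1,q^t)$ onto $\ell$; the images of $\langle(1,0)\rangle$ and $\langle(0,1)\rangle$ under the projectivities that map $\mathbf L_0$ onto it are then called its transversal points. Then $\mathbf L$ is a scattered $\mathbb F_q$-linear set (of rank $t$) of pseudoregulus type if and only if the subgroup of $\mathrm{P\Gamma L}(t,q^t)$ that fixes $\Sigma$ pointwise has a generator $\hat s$ such that $\ell\cap\ell^{\hat s}\neq\emptyset$. Moreover, for every such generator $\hat s$, each of the intersections $\ell\cap\ell^{\hat s}$ and $\ell\cap\ell^{\hat s^{-1}}$ is a single point, these two points are distinct, and they are precisely the transversal points of $\mathbf L$. -/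

import Mathlib

open scoped LinearAlgebra.Projectivization

noncomputable section

namespace PseudoregulusSplash

section

variable {F K V : Type*} [Field F] [Field K]
  [AddCommGroup V] [Module K V] [Module F V]

/-- For an `F`-subspace `U` of `V`, the set `B(U)` of all points `⟨u⟩_K` of `PG_K(V)` with
`u ∈ U`, `u ≠ 0`. -/
def pointsOf (K : Type*) [Field K] [Module K V] (U : Submodule F V) : Set (ℙ K V) :=
  {P | ∃ u ∈ U, ∃ hu : u ≠ 0, P = Projectivization.mk K u hu}

/-- The set of points of `PG_K(V)` that lie in the `K`-subspace `U`. -/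
abbrev pts (U : Submodule K V) : Set (ℙ K V) :=
  (U.projectivization : Set (ℙ K V))

/-- The `F`-subspace `W` of `V` defines a canonical subgeometry `Σ = pointsOf K W` of `PG_K(V)`:
its dimension over `F` is the dimension of `V` over `K`, and it spans `V` over `K`. -/
structure IsCanonicalSubgeometry (K : Type*) [Field K] [Module K V]
    (W : Submodule F V) : Prop where
  finrank_eq : Module.finrank F W = Module.finrank K V
  span_eq_top : Submodule.span K (W : Set V) = ⊤

/-- `H` is (the underlying `F`-space of) a hyperplane of the subgeometry defined by `W`. -/
def IsHyperplane (W H : Submodule F V) : Prop :=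
  H ≤ W ∧ Module.finrank F H + 1 = Module.finrank F W

/-- The span, in `PG_K(V)`, of the points defined by an `F`-subspace, as a `K`-subspace of `V`. -/
def spanOf (K : Type*) [Field K] [Module K V] (H : Submodule F V) : Submodule K V :=
  Submodule.span K (H : Set V)

/-- The splash on `ℓ` of the subgeometry defined by `W`: all points in which `ℓ` meets the spans
of the hyperplanes of the subgeometry. -/
def splash (W : Submodule F V) (ℓ : Submodule K V) : Set (ℙ K V) :=
  {P | ∃ H : Submodule F V, IsHyperplane W H ∧
    P ∈ pts ℓ ∩ pts (spanOf K H)}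

/-- `L` is a scattered `F`-linear set of rank `n`: it is defined by an `n`-dimensional `F`-space
and has the maximal possible size `(q ^ n - 1) / (q - 1) = 1 + q + ⋯ + q ^ (n - 1)`,
where `q = |F|`. -/
def IsScatteredLinearSet (F : Type*) [Field F] [Module F V] (n : ℕ) (L : Set (ℙ K V)) : Prop :=
  (∃ U : Submodule F V, Module.finrank F U = n ∧ L = pointsOf K U) ∧
    L.ncard = ∑ i ∈ Finset.range n, Nat.card F ^ i

/-- The point set `L₀ = {⟨(a, a ^ q)⟩ | a ∈ K, a ≠ 0}` of `PG(1, K)`, where `q = |F|`. -/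
def pseudoregulusModel (F K : Type*) [Field F] [Field K] : Set (ℙ K (Fin 2 → K)) :=
  {P | ∃ (a : K) (h : ![a, a ^ Nat.card F] ≠ 0), P = Projectivization.mk K _ h}

/-- The map from `PG(1, K)` to `PG_K(V)` induced by a `K`-linear isomorphism onto the
two-dimensional space `ℓ`, that is, a projectivity from `PG(1, K)` onto the line `ℓ`. -/
def projectivity {ℓ : Submodule K V} (φ : (Fin 2 → K) ≃ₗ[K] ℓ) : ℙ K (Fin 2 → K) → ℙ K V :=
  Projectivization.map (ℓ.subtype ∘ₗ φ.toLinearMap)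
    (ℓ.injective_subtype.comp φ.injective)

/-- A point set `L` of the line `ℓ` is of pseudoregulus type if it is projectively equivalent to
`L₀`. -/
def IsPseudoregulusType (F : Type*) [Field F] (ℓ : Submodule K V) (L : Set (ℙ K V)) : Prop :=
  ∃ φ : (Fin 2 → K) ≃ₗ[K] ℓ, projectivity φ '' pseudoregulusModel F K = L

/-- The transversal points of a point set `L` of the line `ℓ`: the images of `⟨(1, 0)⟩` and
`⟨(0, 1)⟩` under the projectivities that map `L₀` onto `L`. -/
def transversalPoints (F : Type*) [Field F] (ℓ : Submodule K V) (L : Set (ℙ K V)) :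
    Set (ℙ K V) :=
  {P | ∃ φ : (Fin 2 → K) ≃ₗ[K] ℓ, projectivity φ '' pseudoregulusModel F K = L ∧
    (P = projectivity φ (Projectivization.mk K ![1, 0] (by simp)) ∨
      P = projectivity φ (Projectivization.mk K ![0, 1] (by simp)))}

/-- The group of the collineations of `PG_K(V)` that are induced by bijective semilinear maps
`V → V`, as a group of permutations of the points. -/
def PGammaL (K V : Type*) [Field K] [AddCommGroup V] [Module K V] :
    Subgroup (Equiv.Perm (ℙ K V)) where
  carrier := {g | ∃ (σ : K ≃+* K) (f : V ≃+ V), (∀ (c : K) (v : V), f (c • v) = σ c • f v) ∧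
    ∀ (v : V) (hv : v ≠ 0),
      g (Projectivization.mk K v hv) =
        Projectivization.mk K (f v) ((map_ne_zero_iff f f.injective).2 hv)}
  mul_mem' := by
    rintro g g' ⟨σ, f, hf, hg⟩ ⟨σ', f', hf', hg'⟩
    refine ⟨σ'.trans σ, f'.trans f, fun c v => ?_, fun v hv => ?_⟩
    · simp [hf, hf']
    · simp [hg, hg']
  one_mem' := ⟨RingEquiv.refl K, AddEquiv.refl V, fun _ _ => rfl, fun _ _ => rfl⟩
  inv_mem' := by
    rintro g ⟨σ, f, hf, hg⟩
    refine ⟨σ.symm, f.symm, fun c v => ?_, fun v hv => ?_⟩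
    · rw [AddEquiv.symm_apply_eq, hf]
      simp
    · rw [Equiv.Perm.inv_eq_iff_eq, hg]
      simp

/-- The subgroup of `PΓL` of all collineations that fix every point of the subgeometry defined
by `W`. -/
def pointwiseStabilizer (K : Type*) [Field K] [Module K V] (W : Submodule F V) :
    Subgroup (Equiv.Perm (ℙ K V)) :=
  PGammaL K V ⊓ fixingSubgroup (Equiv.Perm (ℙ K V)) (pointsOf K W)

/-- `s` generates the pointwise stabiliser in `PΓL` of the subgeometry defined by `W`. -/
def IsStabilizerGenerator (W : Submodule F V) (s : Equiv.Perm (ℙ K V)) : Prop :=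
  Subgroup.zpowers s = pointwiseStabilizer K W

end

end PseudoregulusSplash

end

open scoped LinearAlgebra.Projectivization

noncomputable section

namespace PseudoregulusSplash

/-! Write `F` for the field of order `q`, `K` for its extension of degree `t`, and `G` for the
Galois group. An `F`-basis of `W` is a `K`-basis of `V`. In these coordinates the hyperplanes of `Σ`
are the kernels of the nonzero functionals `a` with coefficients in `F`, and the pointwise
stabiliser of `Σ` is `G` acting on coordinates. Since `a(v^σ) = σ(a(v))`, everything reduces to
`F`-linear maps of `K`.

Let `u`, `r` be the images of `(1,0)`, `(0,1)` under a parametrisation of `ℓ`. If no hyperplane span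
contains `r`, then `a ↦ a(r)` is an isomorphism onto `K`. The form `-a(u)` becomes an `F`-linear map
`f` of `x = a(r)`, and `⟨(1,z)⟩` lies in the splash iff `z = f(x)/x` for some `x ≠ 0`. Hence the
splash is the image of `L₀` exactly when `f` has the directions of the Frobenius map. The crux,
`exists_generator_of_directions`, is that this forces `f = cσ` with `σ` a generator of `G`. Then `u`
is a multiple of `r^σ`, so `ℓ` contains both `r` and `r^σ`. Conversely, such a pair spans `ℓ`, and
all generators have the same directions (`directions_generator`).

For the crux, write `f = ∑ a_g g` and draw an edge `j → k` on `G` when `a_{j⁻¹k} ≠ 0`. A minimal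
sinkless set `J` is an induced cycle. The sum over `x` of `∏_{j ∈ J} j(f(x)/x)` depends only on the
directions. If `J ≠ G`, uniqueness of base-`q` digits leaves only the term of the cycle, which is
nonzero, whereas for Frobenius the sum is zero. So `J = G`: a single coefficient survives, and
minimality makes its automorphism a generator.

The transversal points are determined because, for `t ≥ 3`, comparing coefficients of automorphisms
shows that a second conjugate pair on `ℓ` is the first one, possibly reversed
(`galAct_pair_unique`). -/

/-! ### Minimal sinkless sets and base-`q` digits -/

/-- A digraph without sinks contains an induced directed cycle, which is a minimal set
without sinks. -/
lemma exists_minimal_sinkless {G : Type*} [Fintype G] [Nonempty G] (R : G → G → Prop)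
    (hR : ∀ j, ∃ k, R j k) :
    ∃ J : Finset G, J.Nonempty ∧ (∃ φ : Equiv.Perm J, ∀ j k : J, R j k ↔ k = φ j) ∧
      ∀ J' : Finset G, J'.Nonempty → (∀ j ∈ J', ∃ k ∈ J', R j k) → J' ⊆ J → J' = J := by
  classical
  obtain ⟨J, hJ⟩ := exists_minimal_of_wellFoundedLT
    (fun J : Finset G => J.Nonempty ∧ ∀ j ∈ J, ∃ k ∈ J, R j k)
    ⟨Finset.univ, Finset.univ_nonempty, fun j _ => by simpa using hR j⟩
  have hmin : ∀ J' : Finset G, J'.Nonempty → (∀ j ∈ J', ∃ k ∈ J', R j k) → J' ⊆ J → J' = J :=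
    fun J' h1 h2 h3 => le_antisymm h3 (hJ.2 ⟨h1, h2⟩ h3)
  -- The image of a self-map that follows edges is again sinkless, so by minimality it is all of
  -- `J`.
  have hsurj : ∀ χ : J → J, (∀ j : J, R j (χ j)) → Function.Bijective χ := by
    intro χ hχ
    have hne : Nonempty J := hJ.1.1.to_subtype
    have h := hmin (Finset.univ.image fun j => (χ j : G)) (Finset.univ_nonempty.image _)
      (by
        intro j hj
        obtain ⟨i, -, rfl⟩ := Finset.mem_image.1 hj
        exact ⟨χ (χ i), Finset.mem_image_of_mem _ (Finset.mem_univ _), hχ _⟩)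
      (by
        intro j hj
        obtain ⟨i, -, rfl⟩ := Finset.mem_image.1 hj
        exact (χ i).2)
    refine Finite.surjective_iff_bijective.1 fun k => ?_
    have hk : (k : G) ∈ Finset.univ.image fun j => (χ j : G) := by rw [h]; exact k.2
    obtain ⟨i, -, hi⟩ := Finset.mem_image.1 hk
    exact ⟨i, Subtype.ext hi⟩
  have hex : ∀ j : J, ∃ k : J, R j k := fun j => by
    obtain ⟨k, hk, h⟩ := hJ.1.2 j j.2
    exact ⟨⟨k, hk⟩, h⟩
  choose φ hφ using hex
  have hbij := hsurj φ hφ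
  refine ⟨J, hJ.1.1, ⟨Equiv.ofBijective φ hbij, fun j k => ⟨fun hjk => ?_, ?_⟩⟩, hmin⟩
  · obtain ⟨i, rfl⟩ := hbij.2 k
    by_contra hne
    have hij : i ≠ j := by
      rintro rfl
      exact hne rfl
    -- A second edge out of `j` would give an edge-following map that takes the value `φ i` at both
    -- `i` and `j`.
    have hinj := (hsurj (Function.update φ j (φ i)) fun l : J => by
      by_cases hl : l = j
      · subst hl; simpa using hjk
      · simpa [hl] using hφ l).1
    exact hij (hinj (by simp [hij]))
  · rintro rfl
    exact hφ j

/-- The value `q ^ n - 1` requires every digit to be `q - 1 ≥ 1`, and then the digit sum is at least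
`n`. -/
lemma sum_mul_pow_lt {q n : ℕ} (c : Fin n → ℕ) (hc : ∀ i, c i < q)
    (hq : 2 ≤ q) (hn : ∑ i, c i < n) : ∑ i, c i * q ^ (i : ℕ) < q ^ n - 1 := by
  have h1 := (finFunctionFinEquiv fun i => (⟨c i, hc i⟩ : Fin q)).2
  rw [finFunctionFinEquiv_apply] at h1
  refine lt_of_le_of_ne (Nat.le_sub_one_of_lt h1) fun h => hn.not_ge ?_
  have hall : ∀ i, c i ≤ q - 1 := fun i => Nat.le_sub_one_of_lt (hc i)
  have hgeom : ∑ i : Fin n, (q - 1) * q ^ (i : ℕ) = q ^ n - 1 := by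
    rw [Fin.sum_univ_eq_sum_range (fun i => (q - 1) * q ^ i), ← Finset.mul_sum,
      Nat.geomSum_eq hq, Nat.mul_div_cancel' (by simpa using Nat.sub_dvd_pow_sub_pow q 1 n)]
  have heq := (Finset.sum_eq_sum_iff_of_le
    (fun (i : Fin n) _ => Nat.mul_le_mul_right (q ^ (i : ℕ)) (hall i))).1 (h.trans hgeom.symm)
  calc n = ∑ _i : Fin n, 1 := by simp
    _ ≤ ∑ i, c i := Finset.sum_le_sum fun i hi => by
      have := Nat.eq_of_mul_eq_mul_right (by positivity) (heq i hi)
      omega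

lemma digits_unique {q n : ℕ} (hq : 2 ≤ q) {c d : Fin n → ℕ} (hc : ∀ i, c i < q)
    (hd : ∀ i, d i < q) (hcn : ∑ i, c i < n) (hdn : ∑ i, d i < n)
    (h : ∑ i, c i * q ^ (i : ℕ) ≡ ∑ i, d i * q ^ (i : ℕ) [MOD q ^ n - 1]) : c = d := by
  have h1 := h.eq_of_lt_of_lt (sum_mul_pow_lt c hc hq hcn) (sum_mul_pow_lt d hd hq hdn)
  have h2 : (fun i => (⟨c i, hc i⟩ : Fin q)) = fun i => ⟨d i, hd i⟩ := by
    apply finFunctionFinEquiv.injective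
    apply Fin.ext
    simpa only [finFunctionFinEquiv_apply] using h1
  funext i
  exact congrArg Fin.val (congrFun h2 i)

/-! ### Directions of `F`-linear maps of `K` -/

section

variable {F K : Type*} [Field F] [Fintype F] [Field K] [Fintype K] [Algebra F K]

lemma zpowers_frobenius :
    Subgroup.zpowers (FiniteField.frobeniusAlgEquivOfAlgebraic F K) = ⊤ := by
  rw [Subgroup.eq_top_iff']
  intro g
  obtain ⟨i, rfl⟩ := (FiniteField.bijective_frobeniusAlgEquivOfAlgebraic_pow F K).2 g
  exact Subgroup.pow_mem _ (Subgroup.mem_zpowers _) _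

/-- A product of few automorphisms, with multiplicities, of a finite field is determined by its
values. -/
lemma prod_algEquiv_unique (d : (K ≃ₐ[F] K) → ℕ) (hd : ∀ g, d g < Fintype.card F)
    (hdn : ∑ g, d g < Module.finrank F K) (c : (K ≃ₐ[F] K) → ℕ)
    (hcd : ∑ g, c g ≤ ∑ g, d g)
    (h : ∀ x : Kˣ, ∏ g : K ≃ₐ[F] K, g (x : K) ^ c g = ∏ g : K ≃ₐ[F] K, g (x : K) ^ d g) :
    c = d := by
  classical
  induction hN : ∑ g, c g using Nat.strong_induction_on generalizing c with
  | _ N ih =>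
  have hq : 2 ≤ Fintype.card F := Fintype.one_lt_card
  by_cases hc : ∀ g, c g < Fintype.card F
  · let e := Equiv.ofBijective _ (FiniteField.bijective_frobeniusAlgEquivOfAlgebraic_pow F K)
    have key : c ∘ e = d ∘ e := by
      refine digits_unique hq (fun i => hc _) (fun i => hd _) ?_ ?_ ?_
      · exact (e.sum_comp c).trans_lt (hcd.trans_lt hdn)
      · exact (e.sum_comp d).trans_lt hdn
      -- Automorphisms are powers of Frobenius, so at a generator of `Kˣ` the identity compares two
      -- base-`q` expansions modulo `q ^ n - 1`.
      · obtain ⟨x, hx⟩ := IsCyclic.exists_generator (α := Kˣ)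
        have ho : orderOf x = Fintype.card F ^ Module.finrank F K - 1 := by
          rw [orderOf_eq_card_of_forall_mem_zpowers hx, Nat.card_eq_fintype_card,
            Fintype.card_units, Module.card_eq_pow_finrank (K := F) (V := K)]
        rw [← ho, ← pow_eq_pow_iff_modEq]
        have hx1 := h x
        have aux : ∀ c : (K ≃ₐ[F] K) → ℕ, ∏ g : K ≃ₐ[F] K, g (x : K) ^ c g =
            ((x ^ ∑ i, (c ∘ e) i * Fintype.card F ^ (i : ℕ) : Kˣ) : K) := by
          intro c
          rw [← e.prod_comp, Units.val_pow_eq_pow_val, ← Finset.prod_pow_eq_pow_sum]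
          refine Finset.prod_congr rfl fun i _ => ?_
          have : e i (x : K) = (x : K) ^ Fintype.card F ^ (i : ℕ) := by
            simp only [e, Equiv.ofBijective_apply, AlgEquiv.coe_pow,
              FiniteField.coe_frobeniusAlgEquivOfAlgebraic_iterate]
          rw [this, ← pow_mul, mul_comm]; rfl
        rw [aux, aux] at hx1
        exact Units.ext hx1
    funext g
    obtain ⟨i, rfl⟩ := e.surjective g
    exact congrFun key i
  · push Not at hc
    obtain ⟨g, hg⟩ := hc
    let φ := FiniteField.frobeniusAlgEquivOfAlgebraic F K
    -- A carry: `q` factors `g` equal one factor Frobenius times `g`. The total multiplicity drops,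
    -- so by induction the new multiplicities equal `d`, yet their sum is smaller than that of `d`.
    obtain ⟨e, rfl⟩ : ∃ e : (K ≃ₐ[F] K) → ℕ, c = e + Pi.single g (Fintype.card F) := by
      refine ⟨c - Pi.single g (Fintype.card F), ?_⟩
      funext k
      by_cases hk : k = g
      · subst hk; simp [hg]
      · simp [hk]
    have hs : ∀ (k : K ≃ₐ[F] K) (m : ℕ), ∑ i, (e + Pi.single k m : (K ≃ₐ[F] K) → ℕ) i =
        ∑ i, e i + m := fun k m => by
      simp [Finset.sum_add_distrib]
    have hp : ∀ (k : K ≃ₐ[F] K) (m : ℕ) (x : Kˣ),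
        ∏ i : K ≃ₐ[F] K, i (x : K) ^ (e + Pi.single k m : (K ≃ₐ[F] K) → ℕ) i =
        (∏ i : K ≃ₐ[F] K, i (x : K) ^ e i) * k (x : K) ^ m := fun k m x => by
      simp only [Pi.add_apply, pow_add, Finset.prod_mul_distrib]
      congr 1
      rw [Finset.prod_eq_single k] <;> simp +contextual
    have := ih _ (by rw [← hN, hs, hs]; omega) (e + Pi.single (φ * g) 1)
      (by rw [hs] at hcd ⊢; omega) (fun x => by
        rw [← h x, hp, hp, pow_one]; rfl) rfl
    rw [← this, hs, hs] at hcd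
    omega

open Classical in
/-- A sum over `Kˣ` of a quotient of products of automorphisms of `K` vanishes unless numerator
and denominator have the same factors. -/
lemma bijective_of_sum_ne_zero (J : Finset (K ≃ₐ[F] K)) (hJ : J ≠ Finset.univ)
    (φ : J → (K ≃ₐ[F] K))
    (h : ∑ x : Kˣ, ∏ j : J, φ j (x : K) / (j : K ≃ₐ[F] K) (x : K) ≠ 0) :
    Function.Injective φ ∧ ∀ j, φ j ∈ J := by
  let χ : Kˣ →* K :=
    { toFun := fun x => ∏ j : J, φ j (x : K) / (j : K ≃ₐ[F] K) (x : K)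
      map_one' := by simp
      map_mul' := fun x y => by
        simp only [Units.val_mul, map_mul, mul_div_mul_comm, Finset.prod_mul_distrib] }
  have hχ : χ = 1 := by
    by_contra hne
    exact h (sum_hom_units_eq_zero χ hne)
  have hq : 1 < Fintype.card F := Fintype.one_lt_card
  -- The character is trivial, so the numerator (multiplicities of the values of `φ`) and the
  -- denominator (indicator of `J`) agree on `Kˣ`. As `J ≠ G`, the multiplicities sum to less than
  -- the degree, and uniqueness applies.
  have hcd : (fun g => (Finset.univ.filter fun j => φ j = g).card) =
      fun g => if g ∈ J then 1 else 0 := by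
    have hsum : ∑ g, (if g ∈ J then 1 else 0) = J.card := by simp
    refine prod_algEquiv_unique (F := F) _ (fun g => by split_ifs <;> omega) ?_ _ ?_ ?_
    · rw [hsum, ← IsGalois.card_aut_eq_finrank, Nat.card_eq_fintype_card]
      exact (Finset.card_lt_iff_ne_univ J).2 hJ
    · rw [hsum, ← Finset.card_eq_sum_card_fiberwise (fun _ _ => Finset.mem_coe.2 (Finset.mem_univ _))]
      simp
    · intro x
      have hx : ∏ j : J, φ j (x : K) / (j : K ≃ₐ[F] K) (x : K) = 1 := DFunLike.congr_fun hχ x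
      rw [Finset.prod_div_distrib, div_eq_one_iff_eq
        (Finset.prod_ne_zero_iff.2 fun j _ => by simp)] at hx
      have h1 : ∏ g : K ≃ₐ[F] K, g (x : K) ^ (if g ∈ J then 1 else 0) =
          ∏ j : J, (j : K ≃ₐ[F] K) (x : K) := by
        rw [Finset.prod_coe_sort J fun j => j (x : K)]
        simp [pow_ite, Finset.prod_ite_mem]
      rw [h1, ← hx, Finset.prod_comp (fun g : K ≃ₐ[F] K => g (x : K)) φ]
      symm
      apply Finset.prod_subset (Finset.subset_univ _)
      intro g _ hg
      rw [Finset.filter_eq_empty_iff.2, Finset.card_empty, pow_zero]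
      intro j _ hj
      exact hg (Finset.mem_image.2 ⟨j, Finset.mem_univ _, hj⟩)
  have hmem : ∀ j, φ j ∈ J := fun j => by
    by_contra hj
    have := congrFun hcd (φ j)
    simp only [hj, if_false, Finset.card_eq_zero] at this
    exact Finset.notMem_empty j (this ▸ by simp)
  refine ⟨fun i j hij => ?_, hmem⟩
  have := congrFun hcd (φ j)
  simp only [hmem j, if_true] at this
  exact Finset.card_le_one.1 this.le i (by simp [hij]) j (by simp)

/-- The solutions of `f x = z x` form a nonzero `F`-subspace, whose order is divisible by the
characteristic; removing `0` leaves `-1`. -/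
lemma card_directions (f : K →ₗ[F] K) (z : K) (h : ∃ x : Kˣ, f x / x = z) [DecidableEq K] :
    (((Finset.univ.filter fun x : Kˣ => f x / x = z).card : ℕ) : K) = -1 := by
  classical
  let E := LinearMap.ker (f - z • LinearMap.id)
  have hE : ∀ x : K, x ∈ E ↔ f x = z * x := fun x => by
    simp [E, LinearMap.mem_ker, sub_eq_zero]
  have h1 : Fintype.card E = (Finset.univ.filter fun x : Kˣ => f x / x = z).card + 1 := by
    rw [← Finset.card_map ⟨Units.val, Units.val_injective⟩,
      ← Finset.card_insert_of_notMem (a := (0 : K)) (by simp), ← Fintype.card_coe]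
    refine Fintype.card_congr (Equiv.subtypeEquivRight fun x => ?_)
    rw [hE]
    by_cases hx : x = 0
    · simp [hx]
    · simp only [Finset.mem_insert, hx, false_or, Finset.mem_map, Finset.mem_filter,
        Finset.mem_univ, true_and, Function.Embedding.coeFn_mk]
      constructor
      · intro h
        exact ⟨Units.mk0 x hx, by simp [h, hx], rfl⟩
      · rintro ⟨y, hy, rfl⟩
        rwa [div_eq_iff y.ne_zero] at hy
  have h2 : ((Fintype.card E : ℕ) : K) = 0 := by
    rw [Module.card_eq_pow_finrank (K := F) (V := E), Nat.cast_pow]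
    have : ((Fintype.card F : ℕ) : K) = 0 := by
      rw [← map_natCast (algebraMap F K), FiniteField.cast_card_eq_zero, map_zero]
    rw [this, zero_pow]
    obtain ⟨x, hx⟩ := h
    have hxE : (x : K) ∈ E := (hE x).2 (by rwa [div_eq_iff x.ne_zero] at hx)
    have : Nontrivial E := ⟨⟨⟨x, hxE⟩, 0, fun h => x.ne_zero (congrArg Subtype.val h)⟩⟩
    exact Module.finrank_pos.ne'
  rw [h1, Nat.cast_add, Nat.cast_one] at h2
  exact eq_neg_of_add_eq_zero_left h2

open Classical in
/-- Linear maps that determine the same directions have the same power sums of directions. -/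
lemma sum_directions_eq (f g : K →ₗ[F] K)
    (h : ∀ z : K, (∃ x : Kˣ, f x / x = z) ↔ ∃ x : Kˣ, g x / x = z) (P : K → K) :
    ∑ x : Kˣ, P (f x / x) = ∑ x : Kˣ, P (g x / x) := by
  have aux : ∀ f : K →ₗ[F] K, ∑ x : Kˣ, P (f x / x) =
      ∑ z ∈ Finset.univ.image (fun x : Kˣ => f x / x), -P z := fun f => by
    rw [Finset.sum_comp P fun x : Kˣ => f x / x]
    refine Finset.sum_congr rfl fun z hz => ?_
    rw [nsmul_eq_mul, card_directions f z (by simpa using hz)]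
    simp
  rw [aux, aux]
  congr 1
  ext z
  simpa using h z

omit [Fintype F] in
-- By Dedekind the automorphisms are independent over `K`, and their number is the `K`-dimension of
-- `K →ₗ[F] K`.
lemma exists_eq_sum_algEquiv (f : K →ₗ[F] K) :
    ∃ a : (K ≃ₐ[F] K) → K, ∀ x, f x = ∑ g, a g * g x := by
  have hli : LinearIndependent K (fun g : K ≃ₐ[F] K => (g : K →ₐ[F] K).toLinearMap) :=
    (linearIndependent_toLinearMap F K K).comp _ fun g h hgh => by
      ext x; exact DFunLike.congr_fun hgh x
  have hspan := hli.span_eq_top_of_card_eq_finrank' (by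
    rw [Module.finrank_linearMap_self, ← IsGalois.card_aut_eq_finrank, Nat.card_eq_fintype_card])
  have hf : f ∈ Submodule.span K (Set.range fun g : K ≃ₐ[F] K => (g : K →ₐ[F] K).toLinearMap) := by
    rw [hspan]; trivial
  obtain ⟨a, ha⟩ := (Submodule.mem_span_range_iff_exists_fun K).1 hf
  exact ⟨a, fun x => by rw [← ha]; simp⟩

omit [Fintype F] in
lemma algEquiv_coeff_unique (a b : (K ≃ₐ[F] K) → K)
    (h : ∀ x, ∑ g, a g * g x = ∑ g, b g * g x) : a = b := by
  have hli : LinearIndependent K (fun g : K ≃ₐ[F] K => (g : K →ₐ[F] K).toLinearMap) :=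
    (linearIndependent_toLinearMap F K K).comp _ fun g h hgh => by
      ext x; exact DFunLike.congr_fun hgh x
  have := Fintype.linearIndependent_iff.1 hli (fun g => a g - b g) (by
    ext x
    simp [sub_mul, h x])
  funext g
  exact sub_eq_zero.1 (this g)

open Classical in
omit [Fintype F] in
lemma sum_prod_div_expand (a : (K ≃ₐ[F] K) → K) (J : Finset (K ≃ₐ[F] K)) :
    ∑ x : Kˣ, ∏ j ∈ J, j ((∑ g, a g * g (x : K)) / x) =
      ∑ φ : J → (K ≃ₐ[F] K), (∏ j : J, (j : K ≃ₐ[F] K) (a ((j : K ≃ₐ[F] K)⁻¹ * φ j))) *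
        ∑ x : Kˣ, ∏ j : J, φ j (x : K) / (j : K ≃ₐ[F] K) (x : K) := by
  have h1 : ∀ x : Kˣ, ∏ j ∈ J, j ((∑ g, a g * g (x : K)) / x) =
      ∑ φ : J → (K ≃ₐ[F] K), ∏ j : J, ((j : K ≃ₐ[F] K) (a ((j : K ≃ₐ[F] K)⁻¹ * φ j)) *
        (φ j (x : K) / (j : K ≃ₐ[F] K) (x : K))) := fun x => by
    rw [← Finset.prod_coe_sort]
    rw [← Fintype.piFinset_univ, ← Finset.prod_univ_sum (fun _ => Finset.univ)
      (fun (j : J) (k : K ≃ₐ[F] K) => (j : K ≃ₐ[F] K) (a ((j : K ≃ₐ[F] K)⁻¹ * k)) *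
        (k (x : K) / (j : K ≃ₐ[F] K) (x : K)))]
    refine Finset.prod_congr rfl fun j _ => ?_
    rw [map_div₀, map_sum, Finset.sum_div, ← Equiv.sum_comp (Equiv.mulLeft (j : K ≃ₐ[F] K)⁻¹)]
    refine Finset.sum_congr rfl fun k _ => ?_
    simp only [Equiv.coe_mulLeft, map_mul, mul_div_assoc]
    rw [← AlgEquiv.mul_apply, mul_inv_cancel_left]
  simp only [h1]
  rw [Finset.sum_comm]
  simp only [Finset.prod_mul_distrib, Finset.mul_sum]

open Classical in
-- Only the choice `j ↦ j * φ`, with `φ` the Frobenius, occurs. A nonzero sum would make `J` stable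
-- under right multiplication by a generator of the group, hence everything.
lemma sum_prod_frobenius_eq_zero (J : Finset (K ≃ₐ[F] K)) (hJ : J ≠ Finset.univ)
    (hJ' : J.Nonempty) :
    ∑ x : Kˣ, ∏ j ∈ J, j ((FiniteField.frobeniusAlgEquivOfAlgebraic F K (x : K)) / x) = 0 := by
  by_contra h
  let φ := FiniteField.frobeniusAlgEquivOfAlgebraic F K
  have := (bijective_of_sum_ne_zero J hJ (fun j => j * φ) (by
    convert h using 2 with x
    rw [← Finset.prod_coe_sort J]
    simp [φ])).2
  obtain ⟨j, hj⟩ := hJ'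
  have hpow : ∀ n : ℕ, j * φ ^ n ∈ J := fun n => by
    induction n with
    | zero => simpa
    | succ n ih => simpa [pow_succ, mul_assoc] using this ⟨_, ih⟩
  apply hJ
  rw [Finset.eq_univ_iff_forall]
  intro g
  obtain ⟨i, hi⟩ := (FiniteField.bijective_frobeniusAlgEquivOfAlgebraic_pow F K).2 (j⁻¹ * g)
  have := hpow i
  rwa [show φ ^ (i : ℕ) = j⁻¹ * g from hi, mul_inv_cancel_left] at this

/-- An `F`-linear map of `K` with the same directions as the Frobenius map is a multiple of a
generator of the Galois group. -/
theorem exists_generator_of_directions (f : K →ₗ[F] K)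
    (h : ∀ z : K, (∃ x : Kˣ, f x / x = z) ↔
      ∃ x : Kˣ, FiniteField.frobeniusAlgEquivOfAlgebraic F K (x : K) / x = z) :
    ∃ (c : K) (σ : K ≃ₐ[F] K), Subgroup.zpowers σ = ⊤ ∧ ∀ x, f x = c * σ x := by
  classical
  obtain ⟨a, ha⟩ := exists_eq_sum_algEquiv f
  have ha0 : ∃ g, a g ≠ 0 := by
    by_contra! h0
    obtain ⟨x, hx⟩ := (h _).2 ⟨1, rfl⟩
    simp [ha, h0] at hx
  obtain ⟨g₀, hg₀⟩ := ha0
  obtain ⟨J, hJne, ⟨φ, hφ⟩, hmin⟩ := exists_minimal_sinkless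
    (fun j k : K ≃ₐ[F] K => a (j⁻¹ * k) ≠ 0) fun j => ⟨j * g₀, by simpa⟩
  have hJ : J = Finset.univ := by
    by_contra hJ
    have h1 : ∑ x : Kˣ, ∏ j ∈ J, j ((∑ g, a g * g (x : K)) / x) = 0 := by
      rw [← sum_prod_frobenius_eq_zero J hJ hJne]
      simp only [← ha]
      exact sum_directions_eq f (FiniteField.frobeniusAlgEquivOfAlgebraic F K).toLinearMap h
        fun z => ∏ j ∈ J, j z
    -- Only maps of `J` into itself along edges contribute, hence only the cycle `φ`. Its character
    -- sum is `|Kˣ| = -1` in `K`.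
    rw [sum_prod_div_expand, Finset.sum_eq_single fun j => (φ j : K ≃ₐ[F] K)] at h1
    · rcases mul_eq_zero.1 h1 with h1 | h1
      · obtain ⟨j, -, hj⟩ := Finset.prod_eq_zero_iff.1 h1
        exact (hφ j (φ j)).2 rfl (by simpa using hj)
      · have h2 : ∀ x : Kˣ, ∏ j : J, (φ j : K ≃ₐ[F] K) (x : K) / (j : K ≃ₐ[F] K) (x : K) = 1 := by
          intro x
          rw [Finset.prod_div_distrib, Equiv.prod_comp φ fun j : J => (j : K ≃ₐ[F] K) (x : K), div_self]
          exact Finset.prod_ne_zero_iff.2 fun j _ => by simp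
        simp only [h2, Finset.sum_const, Finset.card_univ, nsmul_eq_mul, mul_one,
          Fintype.card_units] at h1
        rw [Nat.cast_sub Fintype.card_pos, FiniteField.cast_card_eq_zero] at h1
        simp at h1
    · intro ψ _ hψ
      by_contra hne
      rw [mul_eq_zero, not_or, Finset.prod_eq_zero_iff] at hne
      have hmem := (bijective_of_sum_ne_zero J hJ ψ hne.2).2
      apply hψ
      funext j
      have : a ((j : K ≃ₐ[F] K)⁻¹ * ψ j) ≠ 0 := fun h0 =>
        hne.1 ⟨j, Finset.mem_univ _, by rw [h0, map_zero]⟩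
      exact congrArg Subtype.val ((hφ j ⟨ψ j, hmem j⟩).1 this)
    · simp
  subst hJ
  have huniq : ∀ g, a g ≠ 0 → g = g₀ := fun g hg => by
    have h1 := (hφ ⟨1, Finset.mem_univ _⟩ ⟨g, Finset.mem_univ _⟩).1 (by simpa)
    have h2 := (hφ ⟨1, Finset.mem_univ _⟩ ⟨g₀, Finset.mem_univ _⟩).1 (by simpa)
    exact congrArg Subtype.val (h1.trans h2.symm)
  refine ⟨a g₀, g₀, ?_, fun x => ?_⟩
  -- The subgroup generated by `g₀` is sinkless, so minimality of the whole group makes it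
  -- everything.
  · have := hmin (Finset.univ.filter fun g => g ∈ Subgroup.zpowers g₀)
      ⟨1, by simp [one_mem]⟩ (fun j hj => ⟨j * g₀, by
        simp only [Finset.mem_filter, Finset.mem_univ, true_and] at hj ⊢
        exact mul_mem hj (Subgroup.mem_zpowers _), by simpa⟩) (Finset.subset_univ _)
    rw [Subgroup.eq_top_iff']
    intro g
    have hg := Finset.mem_univ g
    rw [← this] at hg
    exact (Finset.mem_filter.1 hg).2
  · rw [ha, Finset.sum_eq_single g₀]
    · intro g _ hg
      rw [not_not.1 (mt (huniq g) hg), zero_mul]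
    · simp

omit [Fintype F] in
/-- All generators of the Galois group have the same directions. -/
lemma directions_generator {σ τ : K ≃ₐ[F] K} (hσ : Subgroup.zpowers σ = ⊤) (z : K)
    (h : ∃ x : Kˣ, τ x / x = z) : ∃ x : Kˣ, σ x / x = z := by
  have hτ : τ ∈ Submonoid.powers σ := by
    rw [mem_powers_iff_mem_zpowers, hσ]; trivial
  obtain ⟨n, rfl⟩ := hτ
  obtain ⟨x, rfl⟩ := h
  have hne : ∀ g : K ≃ₐ[F] K, g (x : K) ≠ 0 := fun g => by simp
  dsimp only
  induction n with
  | zero => exact ⟨1, by simp⟩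
  | succ n ih =>
    obtain ⟨y, hy⟩ := ih
    -- Telescoping: `σⁿ(x)/x = σ(y)/y` for `y = x σ(x) ⋯ σⁿ⁻¹(x)`.
    refine ⟨Units.mk0 ((σ ^ n) (x : K)) (hne _) * y, ?_⟩
    rw [pow_succ', AlgEquiv.mul_apply]
    have hx : (σ ^ n) (x : K) ≠ 0 := hne _
    have hx' : (x : K) ≠ 0 := by simp
    have hy' : (y : K) ≠ 0 := by simp
    simp only [Units.val_mul, Units.val_mk0, map_mul]
    rw [div_eq_div_iff hy' hx'] at hy
    rw [div_eq_div_iff (mul_ne_zero hx hy') hx']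
    linear_combination σ ((σ ^ n) (x : K)) * hy

end

/-! ### Hyperplanes and splash in coordinates -/

section

variable {F K V ι : Type*} [Field F] [Field K] [Algebra F K]
  [AddCommGroup V] [Module K V] [Module F V] [IsScalarTower F K V]

lemma isHyperplane_iff {W H : Submodule F V} [FiniteDimensional F W] :
    IsHyperplane W H ↔ ∃ f : W →ₗ[F] F, f ≠ 0 ∧ H = (LinearMap.ker f).map W.subtype := by
  have hmap : ∀ H' : Submodule F W, Module.finrank F (H'.map W.subtype) = Module.finrank F H' :=
    fun H' => Submodule.finrank_map_subtype_eq W H'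
  constructor
  · rintro ⟨hHW, hrank⟩
    obtain ⟨H', rfl⟩ : ∃ H' : Submodule F W, H = H'.map W.subtype :=
      ⟨H.comap W.subtype, by rw [Submodule.map_comap_subtype, inf_eq_right.2 hHW]⟩
    rw [hmap] at hrank
    have hlt : H' < ⊤ := lt_top_iff_ne_top.2 fun h => by
      rw [h, finrank_top] at hrank
      omega
    obtain ⟨f, hf, hle⟩ := Submodule.exists_le_ker_of_lt_top H' hlt
    refine ⟨f, hf, ?_⟩
    rw [Submodule.eq_of_le_of_finrank_eq hle]
    have := Module.Dual.finrank_ker_add_one_of_ne_zero hf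
    omega
  · rintro ⟨f, hf, rfl⟩
    refine ⟨Submodule.map_subtype_le _ _, ?_⟩
    rw [hmap]
    exact Module.Dual.finrank_ker_add_one_of_ne_zero hf

lemma exists_basis [FiniteDimensional F V] [FiniteDimensional K V] {W : Submodule F V}
    (hW : IsCanonicalSubgeometry K W) :
    ∃ b : Module.Basis (Fin (Module.finrank K V)) K V,
      W = Submodule.span F (Set.range b) := by
  let c := Module.finBasisOfFinrankEq F W hW.finrank_eq
  have hc : Submodule.span F (Set.range fun i => (c i : V)) = W := by
    have := congrArg (Submodule.map W.subtype) c.span_eq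
    rwa [Submodule.map_span, ← Set.range_comp, Submodule.map_subtype_top] at this
  have hspan : ⊤ ≤ Submodule.span K (Set.range fun i => (c i : V)) := by
    rw [← hW.span_eq_top, Submodule.span_le]
    conv_lhs => rw [← hc]
    exact Submodule.span_le_restrictScalars F K _
  refine ⟨basisOfTopLeSpanOfCardEqFinrank _ hspan (by simp), ?_⟩
  rw [coe_basisOfTopLeSpanOfCardEqFinrank, hc]

variable [Fintype ι] (b : Module.Basis ι K V)

/-- The linear functional with coefficients in `F` with respect to a basis of `V`. -/
def functional (a : ι → F) : V →ₗ[K] K :=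
  ∑ i, algebraMap F K (a i) • b.coord i

omit [Module F V] [IsScalarTower F K V] in
lemma functional_apply (a : ι → F) (v : V) :
    functional b a v = ∑ i, a i • b.repr v i := by
  simp [functional, Algebra.smul_def]

omit [Module F V] [IsScalarTower F K V] in
lemma functional_single [DecidableEq ι] (i : ι) (v : V) :
    functional b (Pi.single i (1 : F)) v = b.repr v i := by
  rw [functional_apply, Finset.sum_eq_single i] <;> simp +contextual

omit [Module F V] [IsScalarTower F K V] in
variable (F) in
lemma functional_ext {v w : V}
    (h : ∀ a : ι → F, functional b a v = functional b a w) : v = w := by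
  classical
  refine b.repr.injective (Finsupp.ext fun i => ?_)
  simpa only [functional_single] using h (Pi.single i 1)

/-- Evaluation at `v` of the functionals with coefficients in `F`. -/
def evalAt (v : V) : (ι → F) →ₗ[F] K where
  toFun a := functional b a v
  map_add' a a' := by simp [functional_apply, add_smul, Finset.sum_add_distrib]
  map_smul' c a := by simp [functional_apply, mul_smul, Finset.smul_sum]

lemma mem_span_range_iff {v : V} :
    v ∈ Submodule.span F (Set.range b) ↔ ∀ i, b.repr v i ∈ Set.range (algebraMap F K) := by
  rw [Submodule.mem_span_range_iff_exists_fun]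
  constructor
  · rintro ⟨c, rfl⟩ i
    refine ⟨c i, ?_⟩
    simp_rw [← algebraMap_smul K (c _) (b _)]
    rw [b.repr_sum_self]
  · intro h
    choose c hc using h
    refine ⟨c, ?_⟩
    simp_rw [← algebraMap_smul K (c _) (b _), hc]
    exact b.sum_repr v

variable {b}

/-- The hyperplane and one vector `w₀` of `W` outside it span `V` over `K`, so its span is no
smaller than the kernel. -/
lemma spanOf_ker {W : Submodule F V} (hW : W = Submodule.span F (Set.range b)) (a : ι → F)
    (f : W →ₗ[F] F) (hf : f ≠ 0)
    (hfa : ∀ w : W, functional b a (w : V) = algebraMap F K (f w)) :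
    spanOf K ((LinearMap.ker f).map W.subtype) = LinearMap.ker (functional b a) := by
  obtain ⟨w₀, hw₀⟩ : ∃ w, f w ≠ 0 := by
    by_contra! h
    exact hf (LinearMap.ext h)
  have hle : spanOf K ((LinearMap.ker f).map W.subtype) ≤ LinearMap.ker (functional b a) := by
    refine Submodule.span_le.2 ?_
    rintro _ ⟨w, hw, rfl⟩
    simp only [SetLike.mem_coe, LinearMap.mem_ker] at hw ⊢
    rw [Submodule.subtype_apply, hfa, hw, map_zero]
  refine le_antisymm hle fun x hx => ?_
  have htop : ⊤ ≤ spanOf K ((LinearMap.ker f).map W.subtype) ⊔ Submodule.span K {(w₀ : V)} := by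
    rw [← b.span_eq, Submodule.span_le]
    rintro _ ⟨i, rfl⟩
    let w : W := ⟨b i, hW ▸ Submodule.subset_span ⟨i, rfl⟩⟩
    have h1 : w - (f w / f w₀) • w₀ ∈ LinearMap.ker f := by
      simp [hw₀]
    have h2 : b i = ((w - (f w / f w₀) • w₀ : W) : V) +
        algebraMap F K (f w / f w₀) • (w₀ : V) := by
      rw [algebraMap_smul]; simp [w]
    rw [SetLike.mem_coe, h2]
    exact Submodule.add_mem_sup (Submodule.subset_span ⟨_, h1, rfl⟩)
      (Submodule.smul_mem _ _ (Submodule.mem_span_singleton_self _))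
  obtain ⟨h, hh, y, hy, rfl⟩ := Submodule.mem_sup.1 (htop (Submodule.mem_top (x := x)))
  obtain ⟨c, rfl⟩ := Submodule.mem_span_singleton.1 hy
  have hh' := hle hh
  rw [LinearMap.mem_ker] at hx hh'
  rw [map_add, hh', zero_add, map_smul, hfa, smul_eq_mul, mul_eq_zero] at hx
  rcases hx with rfl | hx
  · simpa
  · exact absurd ((map_eq_zero _).1 hx) hw₀

lemma exists_hyperplane_spanOf_iff [FiniteDimensional F V] {W : Submodule F V}
    (hW : W = Submodule.span F (Set.range b)) (U : Submodule K V) :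
    (∃ H, IsHyperplane W H ∧ spanOf K H = U) ↔
      ∃ a : ι → F, a ≠ 0 ∧ LinearMap.ker (functional b a) = U := by
  classical
  have hmem : ∀ i, b i ∈ W := fun i => hW ▸ Submodule.subset_span ⟨i, rfl⟩
  have hb : ∀ (a : ι → F) i, functional b a (b i) = algebraMap F K (a i) := fun a i => by
    rw [functional_apply, Finset.sum_eq_single i]
    · simp [Algebra.smul_def]
    · intro j _ hj
      simp [hj.symm]
    · simp
  constructor
  · rintro ⟨H, hH, rfl⟩
    obtain ⟨f, hf, rfl⟩ := isHyperplane_iff.1 hH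
    have hfa : ∀ w : W, functional b (fun i => f ⟨b i, hmem i⟩) (w : V) =
        algebraMap F K (f w) := by
      rintro ⟨w, hw⟩
      have hw' := hw
      rw [hW] at hw'
      obtain ⟨c, rfl⟩ := (Submodule.mem_span_range_iff_exists_fun F).1 hw'
      have : (⟨∑ i, c i • b i, hw⟩ : W) = ∑ i, c i • ⟨b i, hmem i⟩ := by
        apply Subtype.ext
        simp
      change functional (F := F) b _ (∑ i, c i • b i) = algebraMap F K (f ⟨_, hw⟩)
      rw [this]
      simp_rw [← algebraMap_smul K (c _) (b _)]
      simp only [map_sum, map_smul, hb, smul_eq_mul, map_mul]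
    refine ⟨fun i => f ⟨b i, hmem i⟩, ?_, (spanOf_ker hW _ f hf hfa).symm⟩
    intro h0
    apply hf
    ext w
    have := hfa w
    rw [h0] at this
    simpa [functional_apply] using this.symm
  · rintro ⟨a, ha, rfl⟩
    have hr : ∀ w : W, ∃ c : F, functional b a (w : V) = algebraMap F K c := by
      intro w
      have hw : (w : V) ∈ Submodule.span F (Set.range b) := hW.le w.2
      rw [mem_span_range_iff] at hw
      choose c hc using hw
      exact ⟨∑ i, a i * c i, by simp [functional_apply, ← hc, Algebra.smul_def]⟩
    choose f hf using hr
    let f' : W →ₗ[F] F :=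
      { toFun := f
        map_add' := fun x y => (algebraMap F K).injective (by
          rw [map_add, ← hf, ← hf, ← hf, Submodule.coe_add, map_add])
        map_smul' := fun c x => (algebraMap F K).injective (by
          rw [RingHom.id_apply, smul_eq_mul, map_mul, ← hf, ← hf, Submodule.coe_smul,
            ← algebraMap_smul K c, map_smul, smul_eq_mul]) }
    have hf' : f' ≠ 0 := by
      intro h0
      apply ha
      funext i
      have h1 := hf ⟨b i, hmem i⟩
      rw [show f ⟨b i, hmem i⟩ = 0 from DFunLike.congr_fun h0 _, hb] at h1
      exact (algebraMap F K).injective h1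
    exact ⟨_, isHyperplane_iff.2 ⟨f', hf', rfl⟩, spanOf_ker hW a f' hf' hf⟩

lemma mk_mem_splash_iff [FiniteDimensional F V] {W : Submodule F V}
    (hW : W = Submodule.span F (Set.range b)) (ℓ : Submodule K V) (v : V) (hv : v ≠ 0) :
    Projectivization.mk K v hv ∈ splash W ℓ ↔
      v ∈ ℓ ∧ ∃ a : ι → F, a ≠ 0 ∧ functional b a v = 0 := by
  constructor
  · rintro ⟨H, hH, h1, h2⟩
    obtain ⟨a, ha, hker⟩ := (exists_hyperplane_spanOf_iff hW _).1 ⟨H, hH, rfl⟩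
    have h2' : v ∈ spanOf K H := h2
    rw [← hker] at h2'
    exact ⟨h1, a, ha, h2'⟩
  · rintro ⟨h1, a, ha, h2⟩
    obtain ⟨H, hH, hker⟩ := (exists_hyperplane_spanOf_iff hW _).2 ⟨a, ha, rfl⟩
    refine ⟨H, hH, h1, ?_⟩
    have h2' : v ∈ LinearMap.ker (functional b a) := h2
    rw [← hker] at h2'
    exact h2'

/-! ### The Galois action and the pointwise stabiliser of `Σ` -/

variable (b)

/-- The semilinear map of `V` that acts on coordinates by an automorphism of `K`. -/
def galAct (σ : K ≃ₐ[F] K) : V →ₛₗ[(σ : K →+* K)] V where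
  toFun v := b.equivFun.symm fun i => σ (b.repr v i)
  map_add' v w := by
    rw [← map_add]; congr 1; funext i; simp
  map_smul' c v := by
    rw [← map_smul]; congr 1; funext i; simp

omit [Module F V] [IsScalarTower F K V] in
@[simp]
lemma repr_galAct (σ : K ≃ₐ[F] K) (v : V) (i : ι) :
    b.repr (galAct b σ v) i = σ (b.repr v i) := by
  change b.equivFun (b.equivFun.symm fun i => σ (b.repr v i)) i = _
  rw [LinearEquiv.apply_symm_apply]

omit [Module F V] [IsScalarTower F K V] in
lemma galAct_smul (σ : K ≃ₐ[F] K) (c : K) (v : V) :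
    galAct b σ (c • v) = σ c • galAct b σ v :=
  (galAct b σ).map_smulₛₗ c v

omit [Module F V] [IsScalarTower F K V] in
lemma galAct_mul (σ τ : K ≃ₐ[F] K) (v : V) :
    galAct b (σ * τ) v = galAct b σ (galAct b τ v) := by
  refine b.repr.injective (Finsupp.ext fun i => ?_)
  simp

omit [Module F V] [IsScalarTower F K V] in
lemma galAct_one (v : V) : galAct b (1 : K ≃ₐ[F] K) v = v := by
  refine b.repr.injective (Finsupp.ext fun i => ?_)
  simp

omit [Module F V] [IsScalarTower F K V] in
lemma functional_galAct (σ : K ≃ₐ[F] K) (a : ι → F) (v : V) :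
    functional b a (galAct b σ v) = σ (functional b a v) := by
  simp [functional_apply]

omit [Module F V] [IsScalarTower F K V] in
lemma galAct_injective (σ : K ≃ₐ[F] K) : Function.Injective (galAct b σ) := by
  refine Function.LeftInverse.injective (g := galAct b σ⁻¹) fun v => ?_
  rw [← galAct_mul, inv_mul_cancel, galAct_one]

omit [Module F V] [IsScalarTower F K V] in
lemma galAct_ne_zero (σ : K ≃ₐ[F] K) {v : V} (hv : v ≠ 0) : galAct b σ v ≠ 0 :=
  (map_ne_zero_iff _ (galAct_injective b σ)).2 hv

lemma galAct_eq_self {σ : K ≃ₐ[F] K} {w : V} (hw : w ∈ Submodule.span F (Set.range b)) :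
    galAct b σ w = w := by
  rw [mem_span_range_iff] at hw
  refine b.repr.injective (Finsupp.ext fun i => ?_)
  obtain ⟨c, hc⟩ := hw i
  rw [repr_galAct, ← hc, AlgEquiv.commutes]

/-- The collineations that act on coordinates by automorphisms of `K`. -/
def galPerm : (K ≃ₐ[F] K) →* Equiv.Perm (ℙ K V) :=
  MonoidHom.toHomPerm
    { toFun := fun σ => Projectivization.map (galAct b σ) (galAct_injective b σ)
      map_one' := by
        funext P
        induction P using Projectivization.ind with
        | h v hv =>
          change _ = Projectivization.mk K v hv
          rw [Projectivization.map_mk]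
          congr 1
          exact galAct_one b v
      map_mul' := fun σ τ => by
        funext P
        induction P using Projectivization.ind with
        | h v hv =>
          change _ = Projectivization.map (galAct b σ) (galAct_injective b σ)
            (Projectivization.map (galAct b τ) (galAct_injective b τ) (Projectivization.mk K v hv))
          simp only [Projectivization.map_mk]
          congr 1
          exact galAct_mul b σ τ v }

omit [Module F V] [IsScalarTower F K V] in
lemma galPerm_mk (σ : K ≃ₐ[F] K) (v : V) (hv : v ≠ 0) :
    galPerm b σ (Projectivization.mk K v hv) =
      Projectivization.mk K (galAct b σ v) (galAct_ne_zero b σ hv) :=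
  Projectivization.map_mk _ (galAct_injective b σ) v hv

lemma galPerm_mem (σ : K ≃ₐ[F] K) :
    galPerm b σ ∈ pointwiseStabilizer K (Submodule.span F (Set.range b)) := by
  refine ⟨⟨σ, AddEquiv.ofBijective (galAct b σ)
    ⟨galAct_injective b σ, fun v => ⟨galAct b σ⁻¹ v, ?_⟩⟩, fun c v => galAct_smul b σ c v,
    fun v hv => galPerm_mk b σ v hv⟩, ?_⟩
  · rw [← galAct_mul, mul_inv_cancel, galAct_one]
  · refine (mem_fixingSubgroup_iff _).2 ?_
    rintro _ ⟨w, hw, hw0, rfl⟩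
    rw [Equiv.Perm.smul_def, galPerm_mk]
    congr 1
    exact galAct_eq_self b hw

omit [Module F V] [IsScalarTower F K V] in
lemma galPerm_injective [Nontrivial ι] :
    Function.Injective (galPerm b : (K ≃ₐ[F] K) →* Equiv.Perm (ℙ K V)) := by
  classical
  rw [injective_iff_map_eq_one]
  intro σ hσ
  ext x
  obtain ⟨i, j, hij⟩ := exists_pair_ne ι
  have hv : b i + x • b j ≠ 0 := fun h => by
    have := congrArg (fun v => b.repr v i) h
    simp [hij.symm] at this
  have h1 := galPerm_mk b σ _ hv
  rw [hσ, Equiv.Perm.one_apply, Projectivization.mk_eq_mk_iff'] at h1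
  obtain ⟨c, hc⟩ := h1
  have h2 := congrArg (fun v => b.repr v i) hc
  have h3 := congrArg (fun v => b.repr v j) hc
  simp [hij, hij.symm] at h2 h3
  rw [h2, one_mul] at h3
  exact h3

/-- The semilinear map scales each `b i` by some `μ i`. That it also fixes the points `⟨b i + c • b
j⟩` with `c` in `F` makes all `μ i` equal and the companion automorphism trivial on `F`. Dividing by
the common scalar gives the coordinate action. -/
lemma mem_range_galPerm [Nontrivial ι] {g : Equiv.Perm (ℙ K V)}
    (hg : g ∈ pointwiseStabilizer K (Submodule.span F (Set.range b))) :
    g ∈ (galPerm b : (K ≃ₐ[F] K) →* Equiv.Perm (ℙ K V)).range := by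
  classical
  obtain ⟨⟨σ, f, hf, hgf⟩, hfix⟩ := hg
  have hfix := (mem_fixingSubgroup_iff _).1 hfix
  have hfixed : ∀ w ∈ Submodule.span F (Set.range b), w ≠ 0 → ∃ c : K, f w = c • w := by
    intro w hw hw0
    have h1 := hfix _ ⟨w, hw, hw0, rfl⟩
    rw [Equiv.Perm.smul_def, hgf, Projectivization.mk_eq_mk_iff'] at h1
    obtain ⟨c, hc⟩ := h1
    exact ⟨c, hc.symm⟩
  have hb : ∀ i, b i ∈ Submodule.span F (Set.range b) := fun i => Submodule.subset_span ⟨i, rfl⟩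
  choose μ hμ using fun i => hfixed (b i) (hb i) (b.ne_zero i)
  have hμ0 : ∀ i, μ i ≠ 0 := fun i h => by
    have := hμ i
    rw [h, zero_smul] at this
    exact b.ne_zero i ((map_eq_zero_iff f f.injective).1 this)
  have key : ∀ i j, i ≠ j → ∀ c : F,
      σ (algebraMap F K c) * μ j = μ i * algebraMap F K c := by
    intro i j hij c
    have hv : b i + c • b j ≠ 0 := fun h => by
      have := congrArg (fun v => b.repr v i) h
      rw [← algebraMap_smul K c] at this
      simp [-algebraMap_smul, hij.symm] at this
    obtain ⟨d, hd⟩ := hfixed _ (add_mem (hb i) (Submodule.smul_mem _ c (hb j))) hv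
    rw [← algebraMap_smul K c, map_add, hf, hμ, hμ] at hd
    have h2 := congrArg (fun v => b.repr v i) hd
    have h3 := congrArg (fun v => b.repr v j) hd
    simp [-algebraMap_smul, hij, hij.symm] at h2 h3
    rw [h3, h2]
  have hμeq : ∀ i j, μ i = μ j := fun i j => by
    by_cases hij : i = j
    · rw [hij]
    · simpa using (key i j hij 1).symm
  obtain ⟨i, j, hij⟩ := exists_pair_ne ι
  let τ : K ≃ₐ[F] K := AlgEquiv.ofRingEquiv (f := σ) fun c => by
    have := key i j hij c
    rw [hμeq j i, mul_comm] at this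
    exact mul_left_cancel₀ (hμ0 i) this
  refine ⟨τ, Equiv.ext fun P => ?_⟩
  induction P using Projectivization.ind with
  | h v hv =>
    rw [galPerm_mk, hgf, Projectivization.mk_eq_mk_iff']
    refine ⟨(μ i)⁻¹, ?_⟩
    rw [inv_smul_eq_iff₀ (hμ0 i)]
    conv_lhs => rw [← b.sum_repr v]
    rw [map_sum]
    refine b.repr.injective (Finsupp.ext fun k => ?_)
    simp only [hf, hμ, hμeq _ i, smul_smul]
    rw [map_smul, Finsupp.smul_apply, repr_galAct, b.repr_sum_self, smul_eq_mul, mul_comm]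
    rfl

lemma isStabilizerGenerator_iff [Nontrivial ι] {s : Equiv.Perm (ℙ K V)} :
    IsStabilizerGenerator (Submodule.span F (Set.range b)) s ↔
      ∃ σ : K ≃ₐ[F] K, Subgroup.zpowers σ = ⊤ ∧ s = galPerm b σ := by
  have hrange : pointwiseStabilizer K (Submodule.span F (Set.range b)) =
      (galPerm b : (K ≃ₐ[F] K) →* Equiv.Perm (ℙ K V)).range :=
    le_antisymm (fun g hg => mem_range_galPerm b hg) (by
      rintro _ ⟨σ, rfl⟩
      exact galPerm_mem b σ)
  unfold IsStabilizerGenerator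
  rw [hrange, MonoidHom.range_eq_map]
  constructor
  · intro h
    have hs : s ∈ Subgroup.map (galPerm b : (K ≃ₐ[F] K) →* Equiv.Perm (ℙ K V)) ⊤ :=
      h ▸ Subgroup.mem_zpowers s
    obtain ⟨σ, -, rfl⟩ := hs
    refine ⟨σ, ?_, rfl⟩
    rw [← MonoidHom.map_zpowers] at h
    exact Subgroup.map_injective (galPerm_injective b) h
  · rintro ⟨σ, hσ, rfl⟩
    rw [← MonoidHom.map_zpowers, hσ]

omit [Module F V] [IsScalarTower F K V] in
lemma mk_mem_image_galPerm_iff (σ : K ≃ₐ[F] K) (ℓ : Submodule K V) (v : V) (hv : v ≠ 0) :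
    Projectivization.mk K v hv ∈ galPerm b σ '' pts ℓ ↔ galAct b σ⁻¹ v ∈ ℓ := by
  rw [Equiv.image_eq_preimage_symm, Set.mem_preimage]
  rw [← Equiv.Perm.inv_def, ← map_inv, galPerm_mk]
  exact Iff.rfl

end

/-! ### The model `L₀` and its images on `ℓ` -/

section

variable {F K V ι : Type*} [Field F] [Fintype F] [Field K] [Fintype K] [Algebra F K]
  [AddCommGroup V] [Module K V] {ℓ : Submodule K V} (φ : (Fin 2 → K) ≃ₗ[K] ℓ)

omit [Fintype K] in
lemma coe_lineEquiv_apply (x : Fin 2 → K) :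
    (φ x : V) = x 0 • (φ ![1, 0] : V) + x 1 • (φ ![0, 1] : V) := by
  have hx : x = x 0 • ![1, 0] + x 1 • ![0, 1] := by
    ext i; fin_cases i <;> simp
  conv_lhs => rw [hx]
  simp only [map_add, map_smul, Submodule.coe_add, Submodule.coe_smul]

omit [Fintype K] in
lemma coe_lineEquiv_ne_zero {x : Fin 2 → K} (hx : x ≠ 0) : (φ x : V) ≠ 0 := by
  simpa using hx

omit [Fintype K] in
lemma projectivity_mk (x : Fin 2 → K) (hx : x ≠ 0) :
    projectivity φ (Projectivization.mk K x hx) =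
      Projectivization.mk K (φ x : V) (coe_lineEquiv_ne_zero φ hx) :=
  Projectivization.map_mk _ _ x hx

omit [Fintype K] in
lemma projectivity_injective : Function.Injective (projectivity φ) :=
  Projectivization.map_injective _ _

/-- Free of division, the condition also covers `x 0 = 0`. -/
lemma mk_mem_pseudoregulusModel_iff (x : Fin 2 → K) (hx : x ≠ 0) :
    Projectivization.mk K x hx ∈ pseudoregulusModel F K ↔
      ∃ y : Kˣ, x 1 * y = x 0 * FiniteField.frobeniusAlgEquivOfAlgebraic F K (y : K) := by
  simp only [FiniteField.coe_frobeniusAlgEquivOfAlgebraic]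
  constructor
  · rintro ⟨y, hy, h⟩
    rw [Nat.card_eq_fintype_card] at hy
    have hy0 : y ≠ 0 := by
      rintro rfl
      exact hy (by ext i; fin_cases i <;> simp)
    obtain ⟨c, hc⟩ := (Projectivization.mk_eq_mk_iff' K _ _ _ _).1 h
    refine ⟨Units.mk0 y hy0, ?_⟩
    rw [← hc]
    simp only [Nat.card_eq_fintype_card, Pi.smul_apply, Matrix.cons_val_zero,
      Matrix.cons_val_one, smul_eq_mul, Units.val_mk0]
    ring
  · rintro ⟨y, hy⟩
    have hy0 : (y : K) ≠ 0 := y.ne_zero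
    refine ⟨y, fun h => hy0 (by simpa using congrFun h 0), ?_⟩
    rw [Projectivization.mk_eq_mk_iff']
    refine ⟨x 0 / y, ?_⟩
    ext i
    fin_cases i
    · simp
    · simp only [Nat.card_eq_fintype_card, Fin.mk_one, Pi.smul_apply, Matrix.cons_val_one,
        smul_eq_mul, Matrix.cons_val_fin_one]
      rw [div_mul_eq_mul_div, ← hy, mul_div_cancel_right₀ _ hy0]

omit [Fintype K] in
lemma one_vec_ne_zero (y : K) : (![1, y] : Fin 2 → K) ≠ 0 := fun h => by
  simpa using congrFun h 0

/-- The map `y ↦ ⟨(1, y)⟩`. -/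
def affinePoint (y : K) : ℙ K (Fin 2 → K) :=
  Projectivization.mk K ![1, y] (one_vec_ne_zero y)

omit [Fintype K] in
lemma affinePoint_injective : Function.Injective (affinePoint (K := K)) := by
  intro y z h
  obtain ⟨c, hc⟩ := (Projectivization.mk_eq_mk_iff' K _ _ (one_vec_ne_zero y) (one_vec_ne_zero z)).1 h
  have h0 := congrFun hc 0
  have h1 := congrFun hc 1
  simp at h0 h1
  rw [← h1, h0, one_mul]

/-- As `⟨(y, y ^ q)⟩ = ⟨(1, y ^ (q - 1))⟩`, the points correspond to the `(q - 1)`-th powers in the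
cyclic group `Kˣ`. -/
lemma ncard_pseudoregulusModel :
    (pseudoregulusModel F K).ncard =
      ∑ i ∈ Finset.range (Module.finrank F K), Nat.card F ^ i := by
  classical
  have h2 : 2 ≤ Fintype.card F := Fintype.one_lt_card
  have hdvd : Fintype.card F - 1 ∣ Fintype.card F ^ Module.finrank F K - 1 := by
    simpa using Nat.sub_dvd_pow_sub_pow (Fintype.card F) 1 (Module.finrank F K)
  have himage : pseudoregulusModel F K =
      (fun y : Kˣ => affinePoint (y : K)) ''
        ((powMonoidHom (Fintype.card F - 1) : Kˣ →* Kˣ).range : Set Kˣ) := by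
    ext P
    constructor
    · rintro ⟨y, hy, rfl⟩
      have hy0 : y ≠ 0 := by
        rintro rfl
        exact hy (by ext i; fin_cases i <;> simp)
      refine ⟨_, ⟨Units.mk0 y hy0, rfl⟩, ?_⟩
      refine (Projectivization.mk_eq_mk_iff' K _ _ (one_vec_ne_zero _) hy).2 ⟨y⁻¹, ?_⟩
      ext i
      fin_cases i
      · simp [hy0]
      · simp only [Nat.card_eq_fintype_card, Fin.mk_one, Pi.smul_apply, Matrix.cons_val_one,
          smul_eq_mul, Matrix.cons_val_fin_one, powMonoidHom_apply, Units.val_pow_eq_pow_val,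
          Units.val_mk0]
        rw [inv_mul_eq_iff_eq_mul₀ hy0, ← pow_succ', Nat.sub_add_cancel (by omega)]
    · rintro ⟨_, ⟨y, rfl⟩, rfl⟩
      refine (mk_mem_pseudoregulusModel_iff _ (one_vec_ne_zero _)).2 ⟨y, ?_⟩
      simp only [Matrix.cons_val_one, Matrix.cons_val_fin_one, powMonoidHom_apply,
        Units.val_pow_eq_pow_val, Matrix.cons_val_zero, one_mul,
        FiniteField.coe_frobeniusAlgEquivOfAlgebraic]
      rw [← pow_succ, Nat.sub_add_cancel (by omega)]
  have hinj : Function.Injective fun y : Kˣ => affinePoint (y : K) :=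
    affinePoint_injective.comp Units.val_injective
  rw [himage, Set.ncard_image_of_injective _ hinj,
    ← Nat.card_coe_set_eq]
  have := IsCyclic.card_powMonoidHom_range Kˣ (Fintype.card F - 1)
  refine this.trans ?_
  rw [Nat.card_eq_fintype_card, Fintype.card_units,
    Module.card_eq_pow_finrank (K := F) (V := K), Nat.card_eq_fintype_card, Nat.geomSum_eq h2,
    Nat.gcd_eq_right hdvd]

section

variable [Module F V] [IsScalarTower F K V]

lemma isLinearSet_image_model :
    ∃ U : Submodule F V, Module.finrank F U = Module.finrank F K ∧
      projectivity φ '' pseudoregulusModel F K = pointsOf K U := by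
  let m : K →ₗ[F] V :=
    (LinearMap.toSpanSingleton K V (φ ![1, 0] : V)).restrictScalars F +
      (LinearMap.toSpanSingleton K V (φ ![0, 1] : V)).restrictScalars F ∘ₗ
        (FiniteField.frobeniusAlgEquivOfAlgebraic F K).toLinearMap
  have hm : ∀ y, m y = (φ ![y, y ^ Nat.card F] : V) := fun y => by
    rw [coe_lineEquiv_apply φ ![y, y ^ Nat.card F]]
    simp [m]
  have hinj : Function.Injective m := by
    rw [injective_iff_map_eq_zero]
    intro y hy
    rw [hm] at hy
    have : ![y, y ^ Nat.card F] = 0 := by simpa using hy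
    simpa using congrFun this 0
  refine ⟨LinearMap.range m, LinearMap.finrank_range_of_inj hinj, ?_⟩
  ext P
  constructor
  · rintro ⟨_, ⟨y, hy, rfl⟩, rfl⟩
    refine ⟨m y, ⟨y, rfl⟩, ?_, ?_⟩
    · rw [hm]; exact coe_lineEquiv_ne_zero φ hy
    · rw [projectivity_mk]; congr 1; exact (hm y).symm
  · rintro ⟨_, ⟨y, rfl⟩, hy, rfl⟩
    have hy' : ![y, y ^ Nat.card F] ≠ 0 := fun h => hy (by rw [hm, h]; simp)
    refine ⟨_, ⟨y, hy', rfl⟩, ?_⟩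
    rw [projectivity_mk]; congr 1; exact (hm y).symm

variable [Fintype ι] {b : Module.Basis ι K V} {W : Submodule F V}

lemma image_model_eq_splash_iff (hW : W = Submodule.span F (Set.range b)) :
    projectivity φ '' pseudoregulusModel F K = splash W ℓ ↔
      ∀ x : Fin 2 → K, x ≠ 0 →
        ((∃ y : Kˣ, x 1 * y = x 0 * FiniteField.frobeniusAlgEquivOfAlgebraic F K (y : K)) ↔
          ∃ a : ι → F, a ≠ 0 ∧
            x 0 * functional b a (φ ![1, 0] : V) + x 1 * functional b a (φ ![0, 1] : V) = 0) := by
  have hfin : FiniteDimensional K V := Module.Basis.finiteDimensional_of_finite b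
  have hfin' : FiniteDimensional F V := Module.Finite.trans K V
  have hiff : ∀ x : Fin 2 → K, ∀ hx : x ≠ 0,
      (projectivity φ (Projectivization.mk K x hx) ∈ splash W ℓ ↔ ∃ a : ι → F, a ≠ 0 ∧
        x 0 * functional b a (φ ![1, 0] : V) + x 1 * functional b a (φ ![0, 1] : V) = 0) := by
    intro x hx
    rw [projectivity_mk, mk_mem_splash_iff hW]
    simp only [SetLike.coe_mem, true_and]
    simp_rw [coe_lineEquiv_apply φ x, map_add, map_smul, smul_eq_mul]
  constructor
  · intro h x hx
    rw [← hiff x hx, ← h, (projectivity_injective φ).mem_set_image,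
      mk_mem_pseudoregulusModel_iff]
  · intro h
    ext P
    constructor
    · rintro ⟨Q, hQ, rfl⟩
      induction Q using Projectivization.ind with
      | h x hx => exact (hiff x hx).2 ((h x hx).1 ((mk_mem_pseudoregulusModel_iff x hx).1 hQ))
    · intro hP
      induction P using Projectivization.ind with
      | h v hv =>
        have hvℓ := ((mk_mem_splash_iff hW ℓ v hv).1 hP).1
        have hx : φ.symm ⟨v, hvℓ⟩ ≠ 0 := by simpa using hv
        have hmk : projectivity φ (Projectivization.mk K _ hx) = Projectivization.mk K v hv := by
          rw [projectivity_mk]; congr 1; simp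
        rw [← hmk] at hP ⊢
        exact ⟨_, (mk_mem_pseudoregulusModel_iff _ _).2 ((h _ hx).2 ((hiff _ hx).1 hP)), rfl⟩

omit [Fintype F] [Module F V] [IsScalarTower F K V] in
lemma exists_evalEquiv (hι : Fintype.card ι = Module.finrank F K) {v : V}
    (h : ∀ a : ι → F, functional b a v = 0 → a = 0) :
    ∃ A : (ι → F) ≃ₗ[F] K, ∀ a, A a = functional b a v :=
  ⟨LinearMap.linearEquivOfInjective (evalAt b v)
    ((injective_iff_map_eq_zero (evalAt b v)).2 h) (by simpa using hι), fun _ => rfl⟩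

/-- If the splash is the image of the pseudoregulus model, then the images of the two base points
are conjugate under a generator of the Galois group. -/
lemma exists_galAct_of_image_eq (hι : Fintype.card ι = Module.finrank F K)
    (hW : W = Submodule.span F (Set.range b))
    (h : projectivity φ '' pseudoregulusModel F K = splash W ℓ) :
    ∃ (c : K) (τ : K ≃ₐ[F] K), c ≠ 0 ∧ Subgroup.zpowers τ = ⊤ ∧
      (φ ![1, 0] : V) = c • galAct b τ (φ ![0, 1] : V) := by
  rw [image_model_eq_splash_iff φ hW] at h
  -- `⟨(0, 1)⟩` is not in the model, so its image lies in no hyperplane span.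
  obtain ⟨A, hA⟩ := exists_evalEquiv (b := b) hι (v := (φ ![0, 1] : V)) fun a ha => by
    by_contra ha0
    obtain ⟨y, hy⟩ := (h ![0, 1] (fun h => by simpa using congrFun h 1)).2 ⟨a, ha0, by simp [ha]⟩
    simp at hy
  let f : K →ₗ[F] K := -(evalAt b (φ ![1, 0] : V) ∘ₗ A.symm.toLinearMap)
  have hf : ∀ a : ι → F, f (A a) = -functional b a (φ ![1, 0] : V) := fun a => by
    simp [f, evalAt]
  obtain ⟨c, τ, hτ, hc⟩ := exists_generator_of_directions f fun z => by
    have hz := h ![1, z] (fun h => by simpa using congrFun h 0)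
    simp only [Matrix.cons_val_one, Matrix.cons_val_fin_one, Matrix.cons_val_zero, one_mul] at hz
    have h1 : (∃ x : Kˣ, FiniteField.frobeniusAlgEquivOfAlgebraic F K (x : K) / x = z) ↔
        ∃ y : Kˣ, z * y = FiniteField.frobeniusAlgEquivOfAlgebraic F K (y : K) :=
      exists_congr fun x => by rw [div_eq_iff x.ne_zero, eq_comm]
    rw [h1, hz]
    constructor
    · rintro ⟨x, hx⟩
      rw [div_eq_iff x.ne_zero] at hx
      obtain ⟨a, ha⟩ := A.surjective (x : K)
      refine ⟨a, ?_, ?_⟩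
      · rintro rfl
        exact x.ne_zero (by rw [← ha, map_zero])
      · rw [← ha, hf] at hx
        rw [← hA]
        linear_combination -hx
    · rintro ⟨a, ha, hz⟩
      have hAa : A a ≠ 0 := (map_ne_zero_iff A A.injective).2 ha
      refine ⟨Units.mk0 _ hAa, ?_⟩
      rw [Units.val_mk0, div_eq_iff hAa, hf, hA]
      linear_combination -hz
  -- `f = cτ` says that `a(u) = a(-c r^τ)` for every `a`, and functionals over `F` separate vectors.
  have hu : (φ ![1, 0] : V) = (-c) • galAct b τ (φ ![0, 1] : V) := functional_ext F b fun a => by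
    have := hc (A a)
    rw [hf, hA] at this
    rw [map_smul, functional_galAct, smul_eq_mul, neg_mul, ← this, neg_neg]
  refine ⟨-c, τ, fun h0 => ?_, hτ, hu⟩
  rw [h0, zero_smul] at hu
  exact coe_lineEquiv_ne_zero φ (x := ![1, 0]) (fun h => by simpa using congrFun h 0) hu

/-- A pair of conjugate points that spans `ℓ` determines a projectivity that maps the
pseudoregulus model onto the splash. -/
lemma image_eq_of_galAct (hι : Fintype.card ι = Module.finrank F K)
    (hW : W = Submodule.span F (Set.range b)) {σ : K ≃ₐ[F] K} (hσ : Subgroup.zpowers σ = ⊤)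
    (hr : ∀ a : ι → F, functional b a (φ ![0, 1] : V) = 0 → a = 0)
    (hφ : (φ ![1, 0] : V) = -galAct b σ (φ ![0, 1] : V)) :
    projectivity φ '' pseudoregulusModel F K = splash W ℓ := by
  rw [image_model_eq_splash_iff φ hW]
  obtain ⟨A, hA⟩ := exists_evalEquiv hι hr
  intro x hx
  have h1 : (∃ a : ι → F, a ≠ 0 ∧
      x 0 * functional b a (φ ![1, 0] : V) + x 1 * functional b a (φ ![0, 1] : V) = 0) ↔
      ∃ y : Kˣ, x 1 * y = x 0 * σ y := by
    simp only [hφ, map_neg, functional_galAct, ← hA]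
    constructor
    · rintro ⟨a, ha, h⟩
      refine ⟨Units.mk0 (A a) ((map_ne_zero_iff A A.injective).2 ha), ?_⟩
      rw [Units.val_mk0]
      linear_combination h
    · rintro ⟨y, hy⟩
      obtain ⟨a, ha⟩ := A.surjective (y : K)
      refine ⟨a, ?_, ?_⟩
      · rintro rfl
        exact y.ne_zero (by rw [← ha, map_zero])
      · rw [ha]
        linear_combination hy
  rw [h1]
  by_cases h0 : x 0 = 0
  · have h1 : x 1 ≠ 0 := fun h1 => hx (by ext i; fin_cases i <;> simp [h0, h1])
    simp [h0, h1]
  · have h2 : ∀ τ : K ≃ₐ[F] K, (∃ y : Kˣ, x 1 * y = x 0 * τ y) ↔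
        ∃ y : Kˣ, τ y / y = x 1 / x 0 := fun τ => exists_congr fun y => by
      rw [div_eq_div_iff y.ne_zero h0, mul_comm (x 0), eq_comm]
    rw [h2, h2]
    exact ⟨directions_generator hσ _, directions_generator zpowers_frobenius _⟩

omit [Fintype F] [Module F V] [IsScalarTower F K V] in
/-- At most two points of a line are mapped into it by a generator of the Galois group, and they
are then conjugate. -/
lemma galAct_pair_unique (hι : Fintype.card ι = Module.finrank F K)
    (h3 : 3 ≤ Module.finrank F K)
    {σ τ : K ≃ₐ[F] K} (hσ : Subgroup.zpowers σ = ⊤) (hτ : Subgroup.zpowers τ = ⊤) {r v : V}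
    (hr : ∀ a : ι → F, functional b a r = 0 → a = 0) (hv0 : v ≠ 0)
    (hv : v ∈ Submodule.span K {r, galAct b σ r})
    (hτv : galAct b τ v ∈ Submodule.span K {r, galAct b σ r}) :
    (τ = σ ∧ ∃ c : K, c ≠ 0 ∧ v = c • r) ∨
      (τ = σ⁻¹ ∧ σ⁻¹ ≠ σ ∧ ∃ c : K, c ≠ 0 ∧ v = c • galAct b σ r) := by
  classical
  have horder : ∀ g : K ≃ₐ[F] K, Subgroup.zpowers g = ⊤ → 3 ≤ orderOf g := fun g hg => by
    rwa [← Nat.card_zpowers, hg, Subgroup.card_top, IsGalois.card_aut_eq_finrank]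
  have hne1 : ∀ g : K ≃ₐ[F] K, Subgroup.zpowers g = ⊤ → g ≠ 1 := fun g hg h1 => by
    have := horder g hg
    rw [h1, orderOf_one] at this
    omega
  have hσσ : σ * σ ≠ 1 := fun h => by
    have h1 := Nat.le_of_dvd two_pos (orderOf_dvd_of_pow_eq_one ((pow_two σ).trans h))
    have := horder σ hσ
    omega
  obtain ⟨α, β, rfl⟩ := Submodule.mem_span_pair.1 hv
  obtain ⟨γ, δ, h⟩ := Submodule.mem_span_pair.1 hτv
  obtain ⟨A, hA⟩ := exists_evalEquiv hι hr
  -- With `v = αr + βr^σ` and `v^τ = γr + δr^σ`, apply functionals and let `x = a(r)` run over `K`: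
  -- `γ + δσ = τ(α)τ + τ(β)τσ` as maps. So `α ≠ 0` forces `τ = σ` and `β ≠ 0` forces `τσ = 1`; both
  -- together would give `σ² = 1`, impossible in order at least 3.
  have hcoeff := algEquiv_coeff_unique (F := F)
    (fun g => γ * (if g = 1 then 1 else 0) + δ * if g = σ then 1 else 0)
    (fun g => τ α * (if g = τ then 1 else 0) + τ β * if g = τ * σ then 1 else 0) fun x => by
      obtain ⟨a, rfl⟩ := A.surjective x
      have := congrArg (functional b a) h
      simp only [map_add, galAct_smul, map_smul, functional_galAct, smul_eq_mul, ← hA] at this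
      simpa [add_mul, Finset.sum_add_distrib] using this
  have hτσ : τ * σ ≠ τ := fun h => hne1 σ hσ (mul_eq_left.1 h)
  have hτσ' : τ * σ ≠ σ := fun h => hne1 τ hτ (mul_eq_right.1 h)
  have h1 : α ≠ 0 → τ = σ := fun hα => by
    by_contra hne
    have := congrFun hcoeff τ
    simp [hne1 τ hτ, hne, hτσ.symm] at this
    exact hα ((map_eq_zero τ).1 this.symm)
  have h2 : β ≠ 0 → τ = σ⁻¹ := fun hβ => by
    by_contra hne
    have := congrFun hcoeff (τ * σ)
    simp [hτσ, hτσ', mul_eq_one_iff_eq_inv, hne] at this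
    exact hβ ((map_eq_zero τ).1 this.symm)
  have hinv : σ⁻¹ ≠ σ := fun h => hσσ (by nth_rewrite 1 [← h]; simp)
  by_cases hα : α = 0
  · have hβ : β ≠ 0 := by
      rintro rfl
      simp [hα] at hv0
    exact Or.inr ⟨h2 hβ, hinv, β, hβ, by simp [hα]⟩
  · have hβ : β = 0 := by
      by_contra hβ
      exact hinv ((h2 hβ).symm.trans (h1 hα))
    exact Or.inl ⟨h1 hα, α, hα, by simp [hβ]⟩

end

end

/-! ### Conjugate points on `ℓ` -/

section

variable {F K V ι : Type*} [Field F] [Field K] [Fintype K] [Algebra F K]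
  [AddCommGroup V] [Module K V] [Module F V] [IsScalarTower F K V]
  [Fintype ι] {b : Module.Basis ι K V} {ℓ : Submodule K V}

/-- A point fixed by a generator of the Galois group belongs to the subgeometry. -/
lemma exists_smul_mem_of_galAct_eq_smul {σ : K ≃ₐ[F] K} (hσ : Subgroup.zpowers σ = ⊤) {v : V}
    (hv : v ≠ 0) {c : K} (h : galAct b σ v = c • v) :
    ∃ d : K, d ≠ 0 ∧ d • v ∈ Submodule.span F (Set.range b) := by
  obtain ⟨i, hi⟩ : ∃ i, b.repr v i ≠ 0 := by
    by_contra! h0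
    exact hv (b.repr.injective (Finsupp.ext fun i => by simpa using h0 i))
  have hcoord : ∀ j, σ (b.repr v j) = c * b.repr v j := fun j => by
    simpa using congrArg (fun w => b.repr w j) h
  have hc : c ≠ 0 := by
    rintro rfl
    have := hcoord i
    rw [zero_mul, map_eq_zero] at this
    exact hi this
  -- Normalising one coordinate to `1` cancels `c`: ratios of coordinates are fixed by `σ`, hence
  -- lie in `F`.
  refine ⟨(b.repr v i)⁻¹, inv_ne_zero hi, (mem_span_range_iff b).2 fun j => ?_⟩
  rw [IsGalois.mem_range_algebraMap_iff_fixed]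
  intro τ
  have hτ : τ ∈ Submonoid.powers σ := by
    rw [mem_powers_iff_mem_zpowers, hσ]; trivial
  obtain ⟨n, rfl⟩ := hτ
  have hfix : σ (b.repr ((b.repr v i)⁻¹ • v) j) = b.repr ((b.repr v i)⁻¹ • v) j := by
    simp only [map_smul, Finsupp.smul_apply, smul_eq_mul, map_mul, map_inv₀, hcoord]
    field_simp
  dsimp only
  rw [AlgEquiv.coe_pow]
  exact Function.iterate_fixed hfix n

section

variable (hext : ∀ w ∈ Submodule.span F (Set.range b), w ∈ ℓ → w = 0)
  (hhyp : ∀ a : ι → F, a ≠ 0 → ∃ v ∈ ℓ, functional b a v ≠ 0)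
  (hline : Module.finrank K ℓ = 2)
  {σ : K ≃ₐ[F] K} (hσ : Subgroup.zpowers σ = ⊤) {r : V} (hr0 : r ≠ 0) (hr : r ∈ ℓ)
  (hσr : galAct b σ r ∈ ℓ)

include hext hσ hr0 hr in
lemma linearIndependent_galAct_pair : LinearIndependent K ![r, galAct b σ r] := by
  rw [LinearIndependent.pair_iff' hr0]
  intro c hc
  obtain ⟨d, hd, hmem⟩ := exists_smul_mem_of_galAct_eq_smul hσ hr0 hc.symm
  have := hext _ hmem (ℓ.smul_mem d hr)
  exact hr0 ((smul_eq_zero.1 this).resolve_left hd)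

include hext hline hσ hr0 hr hσr in
lemma span_galAct_pair : Submodule.span K {r, galAct b σ r} = ℓ := by
  have hfin : FiniteDimensional K V := Module.Basis.finiteDimensional_of_finite b
  apply Submodule.eq_of_le_of_finrank_eq
  · rw [Submodule.span_le, Set.insert_subset_iff, Set.singleton_subset_iff]
    exact ⟨hr, hσr⟩
  · have := finrank_span_eq_card (linearIndependent_galAct_pair hext hσ hr0 hr)
    rw [Matrix.range_cons_cons_empty] at this
    rw [this, hline, Fintype.card_fin]

include hext hhyp hline hσ hr0 hr hσr in
-- A hyperplane over `F` through `r` also contains `r^σ`, hence all of `ℓ`.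
lemma eq_zero_of_functional_eq_zero (a : ι → F) (ha : functional b a r = 0) : a = 0 := by
  by_contra ha0
  obtain ⟨v, hv, hva⟩ := hhyp a ha0
  rw [← span_galAct_pair hext hline hσ hr0 hr hσr, Submodule.mem_span_pair] at hv
  obtain ⟨c, d, rfl⟩ := hv
  simp [functional_galAct, ha] at hva

include hext hline hσ hr0 hr hσr in
-- The sign turns the splash equation into `x 1 * y = x 0 * σ y` with `y = a(r)`, the shape of the
-- model.
lemma exists_lineEquiv : ∃ φ : (Fin 2 → K) ≃ₗ[K] ℓ,
    (φ ![1, 0] : V) = -galAct b σ r ∧ (φ ![0, 1] : V) = r := by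
  have hli : LinearIndependent K ![(-⟨galAct b σ r, hσr⟩ : ℓ), ⟨r, hr⟩] := by
    rw [LinearIndependent.pair_symm_iff, LinearIndependent.pair_neg_right_iff]
    apply LinearIndependent.of_comp ℓ.subtype
    convert linearIndependent_galAct_pair hext hσ hr0 hr using 1
    ext i
    fin_cases i <;> rfl
  let B := basisOfLinearIndependentOfCardEqFinrank hli (by simp [hline])
  refine ⟨B.equivFun.symm, ?_, ?_⟩ <;>
  simp [B, Module.Basis.equivFun_symm_apply]

end

end

lemma exists_pair_iff {F K V ι : Type*} [Field F] [Field K] [Algebra F K]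
    [AddCommGroup V] [Module K V] [Fintype ι] (b : Module.Basis ι K V) (ℓ : Submodule K V)
    (σ : K ≃ₐ[F] K) :
    (pts ℓ ∩ galPerm b σ '' pts ℓ).Nonempty ↔ ∃ r, r ≠ 0 ∧ r ∈ ℓ ∧ galAct b σ r ∈ ℓ := by
  constructor
  · rintro ⟨P, hP, hP'⟩
    induction P using Projectivization.ind with
    | h v hv =>
      rw [mk_mem_image_galPerm_iff] at hP'
      refine ⟨galAct b σ⁻¹ v, galAct_ne_zero b _ hv, hP', ?_⟩
      rw [← galAct_mul, mul_inv_cancel, galAct_one]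
      exact hP
  · rintro ⟨r, hr0, hr, hσr⟩
    exact ⟨Projectivization.mk K (galAct b σ r) (galAct_ne_zero b σ hr0), hσr,
      (mk_mem_image_galPerm_iff b σ ℓ _ _).2 (by rwa [← galAct_mul, inv_mul_cancel, galAct_one])⟩

end PseudoregulusSplash

/-! ### The main theorem -/

open PseudoregulusSplash in
theorem theorem2 {F K V : Type*} [Field F] [Finite F] [Field K] [Algebra F K]
    [FiniteDimensional F K] [AddCommGroup V] [Module K V] [Module F V] [IsScalarTower F K V]
    (t : ℕ) (hK : Module.finrank F K = t) (hV : Module.finrank K V = t)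
    (W : Submodule F V) (hW : PseudoregulusSplash.IsCanonicalSubgeometry K W)
    (ℓ : Submodule K V) (hline : Module.finrank K ℓ = 2)
    (hext : Disjoint (PseudoregulusSplash.pts ℓ) (PseudoregulusSplash.pointsOf K W))
    (hhyp : ∀ H : Submodule F V, PseudoregulusSplash.IsHyperplane W H →
      ¬ ℓ ≤ PseudoregulusSplash.spanOf K H) :
    ((PseudoregulusSplash.IsScatteredLinearSet F t (PseudoregulusSplash.splash W ℓ) ∧
        PseudoregulusSplash.IsPseudoregulusType F ℓ (PseudoregulusSplash.splash W ℓ)) ↔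
      ∃ s : Equiv.Perm (ℙ K V), PseudoregulusSplash.IsStabilizerGenerator W s ∧
        (PseudoregulusSplash.pts ℓ ∩ s '' PseudoregulusSplash.pts ℓ).Nonempty) ∧
    (∀ s : Equiv.Perm (ℙ K V), PseudoregulusSplash.IsStabilizerGenerator W s →
      (PseudoregulusSplash.pts ℓ ∩ s '' PseudoregulusSplash.pts ℓ).Nonempty →
      ∃ P P' : ℙ K V, P ≠ P' ∧
        PseudoregulusSplash.pts ℓ ∩ s '' PseudoregulusSplash.pts ℓ = {P} ∧
        PseudoregulusSplash.pts ℓ ∩ (s⁻¹ : Equiv.Perm (ℙ K V)) '' PseudoregulusSplash.pts ℓ = {P'} ∧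
        PseudoregulusSplash.transversalPoints F ℓ (PseudoregulusSplash.splash W ℓ) = {P, P'}) := by
  classical
  have hfinK : Finite K := Module.finite_of_finite F
  let _ := Fintype.ofFinite F
  let _ := Fintype.ofFinite K
  have ht : 0 < t := hK ▸ Module.finrank_pos
  have hfin : FiniteDimensional K V := Module.finite_of_finrank_pos (hV ▸ ht)
  have hfin' : FiniteDimensional F V := Module.Finite.trans K V
  obtain ⟨b, hWb⟩ := exists_basis hW
  have hι : Fintype.card (Fin (Module.finrank K V)) = Module.finrank F K := by
    rw [Fintype.card_fin, hV, hK]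
  have hext' : ∀ w ∈ Submodule.span F (Set.range b), w ∈ ℓ → w = 0 := by
    intro w hw hwℓ
    by_contra hw0
    exact Set.disjoint_left.1 hext (show Projectivization.mk K w hw0 ∈ pts ℓ from hwℓ)
      ⟨w, hWb ▸ hw, hw0, rfl⟩
  have hhyp' : ∀ a : Fin (Module.finrank K V) → F, a ≠ 0 →
      ∃ v ∈ ℓ, functional b a v ≠ 0 := by
    intro a ha
    obtain ⟨H, hH, hker⟩ := (exists_hyperplane_spanOf_iff hWb _).2 ⟨a, ha, rfl⟩
    have := hhyp H hH
    rw [hker] at this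
    exact Set.not_subset.1 this
  -- For `t = 2` the line would be the whole space and meet `Σ`.
  have ht3 : 3 ≤ t := by
    have h2 : 2 ≤ t := by rw [← hline, ← hV]; exact Submodule.finrank_le ℓ
    by_contra hlt
    have htop : ℓ = ⊤ := Submodule.eq_top_of_finrank_eq (by omega)
    have hpos : 0 < Module.finrank K V := by omega
    exact b.ne_zero ⟨0, hpos⟩ (hext' _ (Submodule.subset_span ⟨_, rfl⟩) (htop ▸ trivial))
  have hK3 : 3 ≤ Module.finrank F K := hK ▸ ht3
  have : Nontrivial (Fin (Module.finrank K V)) := Fin.nontrivial_iff_two_le.2 (by omega)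
  have hgen : ∀ s, IsStabilizerGenerator W s ↔
      ∃ σ : K ≃ₐ[F] K, Subgroup.zpowers σ = ⊤ ∧ s = galPerm b σ := fun s => by
    rw [hWb]; exact isStabilizerGenerator_iff b
  have hinv : ∀ σ : K ≃ₐ[F] K, Subgroup.zpowers σ = ⊤ → Subgroup.zpowers σ⁻¹ = ⊤ :=
    fun σ hσ => by rw [Subgroup.zpowers_inv, hσ]
  refine ⟨⟨?_, ?_⟩, ?_⟩
  · rintro ⟨-, φ, hφ⟩
    obtain ⟨c, τ, hc, hτ, hu⟩ := exists_galAct_of_image_eq φ hι hWb hφ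
    refine ⟨galPerm b τ, (hgen _).2 ⟨τ, hτ, rfl⟩, (exists_pair_iff b ℓ τ).2
      ⟨φ ![0, 1], coe_lineEquiv_ne_zero φ fun h => by simpa using congrFun h 1,
        SetLike.coe_mem _, ?_⟩⟩
    rw [← ℓ.smul_mem_iff hc, ← hu]
    exact SetLike.coe_mem _
  · rintro ⟨s, hs, hne⟩
    obtain ⟨σ, hσ, rfl⟩ := (hgen s).1 hs
    obtain ⟨r, hr0, hr, hσr⟩ := (exists_pair_iff b ℓ σ).1 hne
    obtain ⟨φ, hφ0, hφ1⟩ := exists_lineEquiv hext' hline hσ hr0 hr hσr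
    have hφ := image_eq_of_galAct φ hι hWb hσ
      (by rw [hφ1]; exact eq_zero_of_functional_eq_zero hext' hhyp' hline hσ hr0 hr hσr)
      (by rw [hφ0, hφ1])
    refine ⟨⟨?_, ?_⟩, φ, hφ⟩
    · obtain ⟨U, hU, hUeq⟩ := isLinearSet_image_model (F := F) φ
      exact ⟨U, hU.trans hK, hφ.symm.trans hUeq⟩
    · rw [← hφ, Set.ncard_image_of_injective _ (projectivity_injective φ),
        ncard_pseudoregulusModel, hK]
  · intro s hs hne
    obtain ⟨σ, hσ, rfl⟩ := (hgen s).1 hs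
    obtain ⟨r, hr0, hr, hσr⟩ := (exists_pair_iff b ℓ σ).1 hne
    have hspan := span_galAct_pair hext' hline hσ hr0 hr hσr
    have hfun := eq_zero_of_functional_eq_zero hext' hhyp' hline hσ hr0 hr hσr
    have huniq : ∀ {τ : K ≃ₐ[F] K} {v : V}, Subgroup.zpowers τ = ⊤ → v ≠ 0 → v ∈ ℓ →
        galAct b τ v ∈ ℓ → (τ = σ ∧ ∃ c : K, c ≠ 0 ∧ v = c • r) ∨
          (τ = σ⁻¹ ∧ σ⁻¹ ≠ σ ∧ ∃ c : K, c ≠ 0 ∧ v = c • galAct b σ r) :=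
      fun hτ hv0 hv hτv =>
        galAct_pair_unique hι hK3 hσ hτ hfun hv0 (hspan.symm ▸ hv) (hspan.symm ▸ hτv)
    have huniq' : ∀ {v : V}, v ≠ 0 → v ∈ ℓ → galAct b σ v ∈ ℓ →
        ∃ c : K, c ≠ 0 ∧ v = c • r := fun hv0 hv hσv => by
      rcases huniq hσ hv0 hv hσv with ⟨-, h⟩ | ⟨h1, h2, -⟩
      · exact h
      · exact absurd h1.symm h2
    have hσr0 := galAct_ne_zero b σ hr0
    obtain ⟨φ, hφ0, hφ1⟩ := exists_lineEquiv hext' hline hσ hr0 hr hσr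
    have hφ := image_eq_of_galAct φ hι hWb hσ (by rwa [hφ1]) (by rw [hφ0, hφ1])
    -- `ℓ ∩ ℓ^s` is `⟨r^σ⟩`, and `ℓ ∩ ℓ^(s⁻¹)` is `⟨r⟩`.
    refine ⟨Projectivization.mk K (galAct b σ r) hσr0, Projectivization.mk K r hr0, ?_, ?_, ?_, ?_⟩
    · intro h
      obtain ⟨c, hc⟩ := (Projectivization.mk_eq_mk_iff' K _ _ _ _).1 h
      exact (LinearIndependent.pair_iff' hr0).1
        (linearIndependent_galAct_pair hext' hσ hr0 hr) c hc
    · ext P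
      induction P using Projectivization.ind with
      | h v hv =>
        rw [Set.mem_inter_iff, mk_mem_image_galPerm_iff, Set.mem_singleton_iff]
        constructor
        · rintro ⟨h1, h2⟩
          obtain ⟨c, -, hcr⟩ := huniq' (galAct_ne_zero b σ⁻¹ hv) h2
            (by rwa [← galAct_mul, mul_inv_cancel, galAct_one])
          have := congrArg (galAct b σ) hcr
          rw [← galAct_mul, mul_inv_cancel, galAct_one, galAct_smul] at this
          exact (Projectivization.mk_eq_mk_iff' K _ _ _ _).2 ⟨_, this.symm⟩
        · intro h
          obtain ⟨c, rfl⟩ := (Projectivization.mk_eq_mk_iff' K _ _ _ _).1 h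
          refine ⟨ℓ.smul_mem _ hσr, ?_⟩
          rw [galAct_smul, ← galAct_mul, inv_mul_cancel, galAct_one]
          exact ℓ.smul_mem _ hr
    · ext P
      induction P using Projectivization.ind with
      | h v hv =>
        rw [← map_inv, Set.mem_inter_iff, mk_mem_image_galPerm_iff, Set.mem_singleton_iff, inv_inv]
        constructor
        · rintro ⟨h1, h2⟩
          obtain ⟨c, -, hcr⟩ := huniq' hv h1 h2
          exact (Projectivization.mk_eq_mk_iff' K _ _ _ _).2 ⟨_, hcr.symm⟩
        · intro h
          obtain ⟨c, rfl⟩ := (Projectivization.mk_eq_mk_iff' K _ _ _ _).1 h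
          refine ⟨ℓ.smul_mem _ hr, ?_⟩
          rw [galAct_smul]
          exact ℓ.smul_mem _ hσr
    · ext P
      rw [Set.mem_insert_iff, Set.mem_singleton_iff]
      constructor
      · rintro ⟨ψ, hψ, hP⟩
        obtain ⟨c, τ, hc, hτ, hu⟩ := exists_galAct_of_image_eq ψ hι hWb hψ
        have hmem : galAct b τ (ψ ![0, 1] : V) ∈ ℓ := by
          rw [← ℓ.smul_mem_iff hc, ← hu]
          exact SetLike.coe_mem _
        have hv0 : (ψ ![0, 1] : V) ≠ 0 :=
          coe_lineEquiv_ne_zero ψ fun h => by simpa using congrFun h 1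
        simp only [projectivity_mk] at hP
        -- Another projectivity `ψ` gives a conjugate pair for some generator `τ`: either `τ = σ`
        -- and the pair is the same, or `τ = σ⁻¹` and its points are swapped.
        rcases huniq hτ hv0 (SetLike.coe_mem _) hmem with ⟨rfl, d, -, hd⟩ | ⟨rfl, -, d, -, hd⟩
        · rw [hd, galAct_smul, smul_smul] at hu
          rcases hP with rfl | rfl
          · exact Or.inl ((Projectivization.mk_eq_mk_iff' K _ _ _ _).2 ⟨_, hu.symm⟩)
          · exact Or.inr ((Projectivization.mk_eq_mk_iff' K _ _ _ _).2 ⟨_, hd.symm⟩)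
        · rw [hd, galAct_smul, ← galAct_mul, inv_mul_cancel, galAct_one, smul_smul] at hu
          rcases hP with rfl | rfl
          · exact Or.inr ((Projectivization.mk_eq_mk_iff' K _ _ _ _).2 ⟨_, hu.symm⟩)
          · exact Or.inl ((Projectivization.mk_eq_mk_iff' K _ _ _ _).2 ⟨_, hd.symm⟩)
      · rintro (rfl | rfl)
        · refine ⟨φ, hφ, Or.inl ?_⟩
          rw [projectivity_mk]
          exact (Projectivization.mk_eq_mk_iff' K _ _ _ _).2 ⟨-1, by rw [hφ0]; simp⟩
        · refine ⟨φ, hφ, Or.inr ?_⟩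
          rw [projectivity_mk]
          exact (Projectivization.mk_eq_mk_iff' K _ _ _ _).2 ⟨1, by rw [hφ1]; simp⟩

end
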